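/- **Theorem 1.1.** Let $\mathbb T=\mathbb R/2\pi\mathbb Z$, $\hat f_k=\frac1{2\pi}\int_{\mathbb T}e^{-ikx}f(x)\,dx$, and $\|f\|_{H^s}^2=2\pi\sum_{k\in\mathbb Z}(1+k^2)^s|\hat f_k|^2$. Let $\partial_x^{-1}$ be the Fourier multiplier with symbol $(ik)^{-1}$ for $k\ne0$ and $0$ for $k=0$, let $\partial_x^{-2}=(\partial_x^{-1})^2$, and let $\Pi_0(f)=\frac1{2\pi}\int_{\mathbb T}f\,dx$. For $u_0$ put $M_0=\Pi_0(|u_0|^2)$ and $P_0=\Pi_0(u_0\,\partial_x\overline{u_0})$, and for $\tau>0$ define $u^0=u_0$, $u^{n+1}=\Psi(u^n)$, where $$ \begin{aligned} \Psi(w)={}&e^{i\tau(-2M_0-2P_0\partial_x^{-1}+\partial_x^2)}w-i\tau\,\Pi_0(|w|^2w)+2i\tau M_0\,\Pi_0(w)\\ &-\tfrac12\partial_x^{-2}\Big[\big(e^{-i\tau\partial_x^2}\bar w\big)\cdot e^{i\tau\partial_x^2}\big(w^2\big)\Big]+\tfrac12e^{i\tau\partial_x^2}\partial_x^{-2}\big[|w|^2w\big]\\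 &+\partial_x^{-1}\Big[\big(e^{i\tau\partial_x^2}w\big)\cdot\partial_x^{-1}\Big(\big|e^{i\tau\partial_x^2}w\big|^2\Big)\Big]-e^{i\tau\partial_x^2}\partial_x^{-1}\Big[w\cdot\partial_x^{-1}\big(|w|^2\big)\Big]. \end{aligned} $$ Let $\gamma>\frac32$. For all $T>0$ and $R\ge0$ there are constants $\tau_0,C>0$, depending only on $\gamma$, $T$ and $R$, such that the following holds. Let $u_0\in H^\gamma(\mathbb T)$, and let $u\in C([0,T];H^\gamma(\mathbb T))$ be a solution of $$ i\partial_tu+\partial_{xx}u-|u|^2u=0\quad\text{on }(0,T)\times\mathbb T,\qquad u(0)=u_0, $$ with $\|u\|_{L^\infty((0,T);H^\gamma)}\le R$. Then for every $0<\tau\le\tau_0$ and every integer $n\ge0$ with $t_n:=n\tau\le T$, one has $u^n\in H^\gamma(\mathbb T)$ and $$ \|u(t_n)-u^n\|_{H^\gamma}\le C\tau . $$ -/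

import Mathlib

open MeasureTheory Filter Topology
open scoped Real ENNReal ComplexConjugate

noncomputable section

namespace CubicNLS

/-- The torus `ℝ / 2πℤ`.  Its normalized Haar measure `AddCircle.haarAddCircle` is `dx / (2π)`, and
Mathlib's `fourier k` and `fourierCoeff f k` on it are `x ↦ e^{ikx}` and
`(1 / 2π) ∫ e^{-ikx} f(x) dx`. -/
abbrev Torus : Type := AddCircle (2 * π)

instance factTwoPiPos : Fact (0 < 2 * π) := ⟨Real.two_pi_pos⟩

/-- Membership in the Sobolev space `H^s(𝕋)`, `s ≥ 0`. -/
structure MemH (s : ℝ) (f : Torus → ℂ) : Prop where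
  memLp : MemLp f 2 (AddCircle.haarAddCircle (T := 2 * π))
  summable : Summable fun k : ℤ => (1 + (k : ℝ) ^ 2) ^ s * ‖fourierCoeff f k‖ ^ 2

/-- The Sobolev norm `‖f‖_{H^s} = (2π ∑ₖ (1 + k²)^s |f̂ₖ|²)^{1/2}` of a function `f ∈ H^s(𝕋)`. -/
def hNorm (s : ℝ) (f : Torus → ℂ) : ℝ :=
  Real.sqrt (2 * π * ∑' k : ℤ, (1 + (k : ℝ) ^ 2) ^ s * ‖fourierCoeff f k‖ ^ 2)

/-- The norm of `L^∞((0,T); H^s(𝕋))`: the essential supremum of `‖u(t)‖_{H^s}` over `0 < t < T`. -/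
def linftyHNorm (T s : ℝ) (u : ℝ → Torus → ℂ) : ℝ≥0∞ :=
  eLpNorm (fun t => hNorm s (u t)) ∞ (volume.restrict (Set.Ioo 0 T))

/-- The operator that multiplies the `k`-th Fourier coefficient by `m k`, as a pointwise Fourier
series (which converges absolutely on all the functions to which it is applied below). -/
def fourierMultiplier (m : ℤ → ℂ) (f : Torus → ℂ) : Torus → ℂ :=
  fun x => ∑' k : ℤ, m k * fourierCoeff f k * fourier k x

/-- The symbol `ik` of `∂ₓ`. -/
def symD (k : ℤ) : ℂ := Complex.I * k

/-- The symbol of `∂ₓ⁻¹`: `(ik)⁻¹` for `k ≠ 0` and `0` for `k = 0`. -/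
def symDInv (k : ℤ) : ℂ := if k = 0 then 0 else (Complex.I * k)⁻¹

/-- `∂ₓ` -/
def dx (f : Torus → ℂ) : Torus → ℂ := fourierMultiplier symD f

/-- `∂ₓ⁻¹` -/
def dxInv (f : Torus → ℂ) : Torus → ℂ := fourierMultiplier symDInv f

/-- `∂ₓ⁻² = (∂ₓ⁻¹)²` -/
def dxInvSq (f : Torus → ℂ) : Torus → ℂ := fourierMultiplier (fun k => symDInv k ^ 2) f

/-- `e^{iτ∂ₓ²}` -/
def freeFlow (τ : ℝ) (f : Torus → ℂ) : Torus → ℂ :=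
  fourierMultiplier (fun k => Complex.exp (Complex.I * τ * symD k ^ 2)) f

/-- `e^{iτ(-2M - 2P∂ₓ⁻¹ + ∂ₓ²)}` for complex numbers `M` and `P`. -/
def modifiedFlow (τ : ℝ) (M P : ℂ) (f : Torus → ℂ) : Torus → ℂ :=
  fourierMultiplier
    (fun k => Complex.exp (Complex.I * τ * (-2 * M - 2 * P * symDInv k + symD k ^ 2))) f

/-- The zero mode `Π₀(f) = (1 / 2π) ∫ f dx`. -/
def zeroMode (f : Torus → ℂ) : ℂ := ∫ x, f x ∂(AddCircle.haarAddCircle (T := 2 * π))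

/-- The pointwise complex conjugate of `f`. -/
def conjFun (f : Torus → ℂ) : Torus → ℂ := fun x => conj (f x)

/-- `|f|²`, as a complex-valued function. -/
def absSq (f : Torus → ℂ) : Torus → ℂ := fun x => ((‖f x‖ ^ 2 : ℝ) : ℂ)

/-- The cubic nonlinearity `|f|² f`. -/
def cubic (f : Torus → ℂ) : Torus → ℂ := absSq f * f

/-- The mass `M₀ = Π₀(|u₀|²)`. -/
def mass (u₀ : Torus → ℂ) : ℂ := zeroMode (absSq u₀)

/-- The momentum `P₀ = Π₀(u₀ ∂ₓ ū₀)`. -/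
def momentum (u₀ : Torus → ℂ) : ℂ := zeroMode (u₀ * dx (conjFun u₀))

/-- One step `Ψ` of the Fourier integrator, with step size `τ` and parameters `M = M₀`, `P = P₀`. -/
def Psi (τ : ℝ) (M P : ℂ) (w : Torus → ℂ) : Torus → ℂ := fun x =>
  modifiedFlow τ M P w x
    - Complex.I * τ * zeroMode (cubic w)
    + 2 * Complex.I * τ * M * zeroMode w
    - 1 / 2 * dxInvSq (freeFlow (-τ) (conjFun w) * freeFlow τ (w ^ 2)) x
    + 1 / 2 * freeFlow τ (dxInvSq (cubic w)) x
    + dxInv (freeFlow τ w * dxInv (absSq (freeFlow τ w))) x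
    - freeFlow τ (dxInv (w * dxInv (absSq w))) x

/-- The numerical solution: `u⁰ = u₀`, `uⁿ⁺¹ = Ψ(uⁿ)`, where `M₀` and `P₀` are computed from `u₀`. -/
def numSol (τ : ℝ) (u₀ : Torus → ℂ) : ℕ → Torus → ℂ
  | 0 => u₀
  | n + 1 => Psi τ (mass u₀) (momentum u₀) (numSol τ u₀ n)

/-- `u ∈ C([0,T]; H^γ(𝕋))` solves `i ∂ₜu + ∂ₓₓu - |u|²u = 0` on `(0,T) × 𝕋` with `u(0) = u₀`.
The equation is meant in the sense of distributions in `x`: it is tested against the exponentials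
`e^{-ikx}`, `k ∈ ℤ`, which span a dense subspace of the smooth functions on `𝕋`. -/
structure IsSolution (γ T : ℝ) (u₀ : Torus → ℂ) (u : ℝ → Torus → ℂ) : Prop where
  memH : ∀ t ∈ Set.Icc 0 T, MemH γ (u t)
  continuous : ∀ t ∈ Set.Icc 0 T,
    Tendsto (fun s => hNorm γ (u s - u t)) (𝓝[Set.Icc 0 T] t) (𝓝 0)
  initial : u 0 =ᵐ[AddCircle.haarAddCircle (T := 2 * π)] u₀
  equation : ∀ t ∈ Set.Ioo 0 T, ∀ k : ℤ, ∃ c : ℂ,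
    HasDerivAt (fun s => fourierCoeff (u s) k) c t ∧
      Complex.I * c + symD k ^ 2 * fourierCoeff (u t) k - fourierCoeff (cubic (u t)) k = 0

end CubicNLS

end

open MeasureTheory Filter Topology
open scoped Real ENNReal ComplexConjugate

noncomputable section

namespace CubicNLS

/-! ### Weighted square-summable sequences -/

/-! Let `c t` be the Fourier coefficients of the solution and `v_k(s) = e^{isk²} c_k(t₀+s)`. Write
`k = a+b+c`, where `a` is the frequency of the conjugated factor. The equation becomes `v_k' = -i ∑
e^{isφ} v̄ v v` with `φ = k²+a²-b²-c² = 2(a+b)(a+c)`. Freezing `v` at `w = v(0)` changes the right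
side by `O(s)` in `H^γ`, hence one step by `O(τ²)`.

For `k ≠ 0` the frozen term is split by `1 = (a+b)/k + (a+c)/k - a/k`. The first two parts are equal
after exchanging `b` and `c`, and `(a+c)/k · e^{isφ}` has the explicit primitive
`e^{isφ}/(2ik(a+b))` off the resonance `a+b = 0`. On the resonance it is a linear term governed by
mass and momentum (`cub_resSymbol`); both are conserved (`SeqSol.quadForm_eq`), so their initial
values may be used in an exponential. In the part `a/k`, the phase `φ = 2ka+2bc` is replaced by
`2ka`, which again integrates explicitly. For `k = 0`, where `φ = 2bc`, the oscillation is replaced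
by `1`. `cub_stepSymbolDeriv` records that the scheme does exactly this.

The replacement error has a symbol of size `s|a||b||c|/|k|`, or `s|b||c|` when `k = 0`. No
derivative is lost, because symbols bounded by `⟨a⟩⟨b⟩⟨c⟩/⟨k⟩` act boundedly on `H^γ` exactly in the
range where `⟨k⟩|w_k|` is summable by Cauchy–Schwarz, `γ > 3/2` (`SobBd.tri`). This gives the local
error `O(τ²)` (`SeqSol.local_error`); with the Lipschitz constant `1+O(τ)` of one step
(`SobBd.stepSeq_sub`) it gives first order convergence (`exists_global_error`). `HasFS.psi`
identifies the scheme on functions with the one on coefficients. -/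

/-- The Japanese bracket `⟨k⟩ = (1 + k²)^{1/2}`. -/
def bracket (k : ℤ) : ℝ := Real.sqrt (1 + (k : ℝ) ^ 2)

lemma bracket_sq (k : ℤ) : bracket k ^ 2 = 1 + (k : ℝ) ^ 2 :=
  Real.sq_sqrt (by positivity)

lemma one_le_bracket (k : ℤ) : 1 ≤ bracket k :=
  Real.one_le_sqrt.2 (by nlinarith [sq_nonneg (k : ℝ)])

lemma bracket_pos (k : ℤ) : 0 < bracket k := lt_of_lt_of_le one_pos (one_le_bracket k)

lemma abs_le_bracket (k : ℤ) : |(k : ℝ)| ≤ bracket k :=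
  Real.abs_le_sqrt (by linarith)

lemma bracket_neg (k : ℤ) : bracket (-k) = bracket k := by simp [bracket]

lemma bracket_le_one_add_abs (k : ℤ) : bracket k ≤ 1 + |(k : ℝ)| := by
  refine Real.sqrt_le_iff.2 ⟨by positivity, ?_⟩
  nlinarith [sq_abs (k : ℝ), abs_nonneg (k : ℝ)]

lemma bracket_le_two_mul_abs {k : ℤ} (hk : k ≠ 0) : bracket k ≤ 2 * |(k : ℝ)| := by
  have h1 : (1 : ℝ) ≤ |(k : ℝ)| := by exact_mod_cast Int.one_le_abs hk
  linarith [bracket_le_one_add_abs k]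

lemma bracket_add_le (j k : ℤ) : bracket (j + k) ≤ bracket j + bracket k := by
  refine Real.sqrt_le_iff.2 ⟨by linarith [bracket_pos j, bracket_pos k], ?_⟩
  have h1 : (j : ℝ) * k ≤ bracket j * bracket k := by
    calc (j : ℝ) * k ≤ |(j : ℝ) * k| := le_abs_self _
      _ = |(j : ℝ)| * |(k : ℝ)| := abs_mul _ _
      _ ≤ _ := mul_le_mul (abs_le_bracket j) (abs_le_bracket k) (abs_nonneg _) (bracket_pos j).le
  push_cast
  nlinarith [bracket_sq j, bracket_sq k]

lemma bracket_add_add_rpow_le {σ : ℝ} (hσ : 0 ≤ σ) (a b c : ℤ) :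
    bracket (a + b + c) ^ σ ≤ 3 ^ σ * (bracket a ^ σ + bracket b ^ σ + bracket c ^ σ) := by
  have ha := bracket_pos a
  have hb := bracket_pos b
  have hc := bracket_pos c
  set m := max (bracket a) (max (bracket b) (bracket c)) with hm
  have hm0 : 0 < m := lt_of_lt_of_le ha (le_max_left _ _)
  have h1 : bracket (a + b + c) ≤ 3 * m := by
    have h2 := bracket_add_le (a + b) c
    have h3 := bracket_add_le a b
    have h4 : bracket a ≤ m := le_max_left _ _
    have h5 : bracket b ≤ m := (le_max_left _ _).trans (le_max_right _ _)
    have h6 : bracket c ≤ m := (le_max_right _ _).trans (le_max_right _ _)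
    linarith
  calc bracket (a + b + c) ^ σ ≤ (3 * m) ^ σ :=
        Real.rpow_le_rpow (bracket_pos _).le h1 hσ
    _ = 3 ^ σ * m ^ σ := Real.mul_rpow (by norm_num) hm0.le
    _ ≤ _ := by
        refine mul_le_mul_of_nonneg_left ?_ (by positivity)
        have hA : 0 ≤ bracket a ^ σ := by positivity
        have hB : 0 ≤ bracket b ^ σ := by positivity
        have hC : 0 ≤ bracket c ^ σ := by positivity
        rcases max_choice (bracket a) (max (bracket b) (bracket c)) with h | h
        · rw [hm, h]; linarith
        · rcases max_choice (bracket b) (bracket c) with h' | h'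
          · rw [hm, h, h']; linarith
          · rw [hm, h, h']; linarith

lemma bracket_rpow_sq (s : ℝ) (k : ℤ) : (bracket k ^ s) ^ 2 = (1 + (k : ℝ) ^ 2) ^ s := by
  rw [← bracket_sq, ← Real.rpow_natCast, ← Real.rpow_natCast, ← Real.rpow_mul (bracket_pos k).le,
    ← Real.rpow_mul (bracket_pos k).le, mul_comm]

lemma one_le_bracket_rpow {s : ℝ} (hs : 0 ≤ s) (k : ℤ) : 1 ≤ bracket k ^ s :=
  Real.one_le_rpow (one_le_bracket k) hs

lemma summable_bracket_rpow_neg {b : ℝ} (hb : 1 < b) : Summable fun k : ℤ => bracket k ^ (-b) := by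
  refine Summable.of_norm_bounded_eventually (Real.summable_abs_int_rpow hb) ?_
  have : ({0} : Set ℤ)ᶜ ∈ cofinite := (Set.finite_singleton 0).compl_mem_cofinite
  filter_upwards [this] with k hk
  have hk' : k ≠ 0 := by simpa using hk
  rw [Real.norm_of_nonneg (Real.rpow_nonneg (bracket_pos k).le _)]
  exact Real.rpow_le_rpow_of_nonpos (abs_pos.2 (by exact_mod_cast hk')) (abs_le_bracket k)
    (by linarith)

/-- `SobBd s a B` says that `(∑ₖ ⟨k⟩^{2s} ‖aₖ‖²)^{1/2} ≤ B`. -/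
structure SobBd {E : Type*} [SeminormedAddCommGroup E] (s : ℝ) (a : ℤ → E) (B : ℝ) : Prop where
  nonneg : 0 ≤ B
  sum_le : ∀ S : Finset ℤ, ∑ k ∈ S, (bracket k ^ s * ‖a k‖) ^ 2 ≤ B ^ 2

namespace SobBd

variable {E F : Type*} [SeminormedAddCommGroup E] [SeminormedAddCommGroup F]

lemma mono {s : ℝ} {a : ℤ → E} {A B : ℝ} (h : SobBd s a A) (hAB : A ≤ B) : SobBd s a B :=
  ⟨h.nonneg.trans hAB, fun S => (h.sum_le S).trans (pow_le_pow_left₀ h.nonneg hAB 2)⟩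

lemma of_norm_le {s : ℝ} {a : ℤ → E} {b : ℤ → F} {B c : ℝ} (h : SobBd s b B) (hc : 0 ≤ c)
    (hab : ∀ k, ‖a k‖ ≤ c * ‖b k‖) : SobBd s a (c * B) := by
  refine ⟨mul_nonneg hc h.nonneg, fun S => ?_⟩
  calc ∑ k ∈ S, (bracket k ^ s * ‖a k‖) ^ 2
      ≤ ∑ k ∈ S, c ^ 2 * (bracket k ^ s * ‖b k‖) ^ 2 := by
        refine Finset.sum_le_sum fun k _ => ?_
        rw [← mul_pow]
        have := Real.rpow_nonneg (bracket_pos k).le s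
        refine pow_le_pow_left₀ (by positivity) ?_ 2
        calc bracket k ^ s * ‖a k‖ ≤ bracket k ^ s * (c * ‖b k‖) :=
              mul_le_mul_of_nonneg_left (hab k) this
          _ = _ := by ring
    _ ≤ (c * B) ^ 2 := by
        rw [← Finset.mul_sum, mul_pow]
        exact mul_le_mul_of_nonneg_left (h.sum_le S) (by positivity)

lemma of_norm_le' {s : ℝ} {a : ℤ → E} {b : ℤ → F} {B : ℝ} (h : SobBd s b B)
    (hab : ∀ k, ‖a k‖ ≤ ‖b k‖) : SobBd s a B := by
  simpa using h.of_norm_le zero_le_one (by simpa using hab)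

lemma add {s : ℝ} {a b : ℤ → E} {A B : ℝ} (ha : SobBd s a A) (hb : SobBd s b B) :
    SobBd s (fun k => a k + b k) (A + B) := by
  refine ⟨add_nonneg ha.nonneg hb.nonneg, fun S => ?_⟩
  have h1 := ha.sum_le S
  have h2 := hb.sum_le S
  have h3 := Finset.sum_mul_sq_le_sq_mul_sq S (fun k => bracket k ^ s * ‖a k‖)
    (fun k => bracket k ^ s * ‖b k‖)
  have h4 : ∑ k ∈ S, (bracket k ^ s * ‖a k‖) * (bracket k ^ s * ‖b k‖) ≤ A * B := by
    refine abs_le_of_sq_le_sq' ?_ (mul_nonneg ha.nonneg hb.nonneg) |>.2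
    rw [mul_pow]
    exact h3.trans (mul_le_mul h1 h2 (Finset.sum_nonneg fun _ _ => sq_nonneg _) (sq_nonneg _))
  calc ∑ k ∈ S, (bracket k ^ s * ‖a k + b k‖) ^ 2
      ≤ ∑ k ∈ S, ((bracket k ^ s * ‖a k‖) ^ 2 +
          2 * ((bracket k ^ s * ‖a k‖) * (bracket k ^ s * ‖b k‖)) +
          (bracket k ^ s * ‖b k‖) ^ 2) := by
        refine Finset.sum_le_sum fun k _ => ?_
        have := Real.rpow_nonneg (bracket_pos k).le s
        calc (bracket k ^ s * ‖a k + b k‖) ^ 2 ≤ (bracket k ^ s * (‖a k‖ + ‖b k‖)) ^ 2 := by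
              gcongr
              exact norm_add_le _ _
          _ = _ := by ring
    _ ≤ (A + B) ^ 2 := by
        rw [Finset.sum_add_distrib, Finset.sum_add_distrib, ← Finset.mul_sum]
        nlinarith

lemma neg {s : ℝ} {a : ℤ → E} {A : ℝ} (ha : SobBd s a A) : SobBd s (fun k => -a k) A :=
  ha.of_norm_le' fun k => by simp

lemma sub {s : ℝ} {a b : ℤ → E} {A B : ℝ} (ha : SobBd s a A) (hb : SobBd s b B) :
    SobBd s (fun k => a k - b k) (A + B) := by
  simpa [sub_eq_add_neg] using ha.add hb.neg

lemma zero (s : ℝ) : SobBd s (fun _ => (0 : E)) 0 := ⟨le_rfl, fun S => by simp⟩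

lemma sum {ι : Type*} {s : ℝ} {a : ι → ℤ → E} {B : ι → ℝ} (h : ∀ i, SobBd s (a i) (B i))
    (P : Finset ι) : SobBd s (fun k => ∑ i ∈ P, a i k) (∑ i ∈ P, B i) := by
  classical
  induction P using Finset.induction_on with
  | empty => simpa using zero s
  | insert i P hi ih => simpa [Finset.sum_insert hi] using (h i).add ih

/-- A Fatou lemma: the bound involves only finite sums, so componentwise convergence suffices. It
serves both for infinite sums of sequences and for carrying a bound from a dense set of times to all
times. -/
lemma of_tendsto {ι : Type*} {l : Filter ι} [l.NeBot] {s : ℝ} {a : ι → ℤ → E} {a' : ℤ → E} {B : ℝ}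
    (h : ∀ᶠ i in l, SobBd s (a i) B) (ha : ∀ k, Tendsto (fun i => a i k) l (𝓝 (a' k))) :
    SobBd s a' B := by
  obtain ⟨i₀, h₀⟩ := h.exists
  refine ⟨h₀.nonneg, fun S => ?_⟩
  refine le_of_tendsto (x := l) (f := fun i => ∑ k ∈ S, (bracket k ^ s * ‖a i k‖) ^ 2) ?_
    (h.mono fun i hi => hi.sum_le S)
  exact tendsto_finsetSum _ fun k _ => ((ha k).norm.const_mul _).pow 2

lemma tsum {ι : Type*} {s : ℝ} {a : ι → ℤ → E} {B : ι → ℝ} (h : ∀ i, SobBd s (a i) (B i))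
    (hB : Summable B) (ha : ∀ k, Summable fun i => a i k) :
    SobBd s (fun k => ∑' i, a i k) (∑' i, B i) :=
  of_tendsto (l := atTop) (a := fun (P : Finset ι) k => ∑ i ∈ P, a i k)
    (.of_forall fun P => (sum h P).mono (hB.sum_le_tsum P fun i _ => (h i).nonneg))
    fun k => (ha k).hasSum

lemma bracket_mul_norm_le {s : ℝ} {a : ℤ → E} {A : ℝ} (ha : SobBd s a A) (k : ℤ) :
    bracket k ^ s * ‖a k‖ ≤ A := by
  have := ha.sum_le {k}
  rw [Finset.sum_singleton] at this
  exact (abs_le_of_sq_le_sq' this ha.nonneg).2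

lemma norm_le {s : ℝ} (hs : 0 ≤ s) {a : ℤ → E} {A : ℝ} (ha : SobBd s a A) (k : ℤ) : ‖a k‖ ≤ A :=
  le_trans (le_mul_of_one_le_left (norm_nonneg _) (one_le_bracket_rpow hs k))
    (ha.bracket_mul_norm_le k)

lemma weight {s t : ℝ} {a : ℤ → E} {A : ℝ} (ha : SobBd (s + t) a A) :
    SobBd s (fun k => bracket k ^ t * ‖a k‖) A := by
  refine ⟨ha.nonneg, fun S => le_of_eq_of_le (Finset.sum_congr rfl fun k _ => ?_) (ha.sum_le S)⟩
  have := Real.rpow_nonneg (bracket_pos k).le t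
  rw [Real.norm_of_nonneg (by positivity), Real.rpow_add (bracket_pos k)]
  ring

lemma shift {a : ℤ → E} {A : ℝ} (ha : SobBd 0 a A) (j : ℤ) : SobBd 0 (fun k => a (k - j)) A := by
  refine ⟨ha.nonneg, fun S => ?_⟩
  have := ha.sum_le (S.map (Equiv.subRight j).toEmbedding)
  simpa using this

/-- A weighted `ℓ²` bound of order `s > 3/2` controls `∑ₖ ⟨k⟩ ‖aₖ‖`. -/
lemma summable_bracket_mul {s : ℝ} (hs : 3 / 2 < s) {a : ℤ → E} {A : ℝ} (ha : SobBd s a A) :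
    (Summable fun k => bracket k * ‖a k‖) ∧
      ∑' k, bracket k * ‖a k‖ ≤ Real.sqrt (∑' k : ℤ, bracket k ^ (-(2 * s - 2))) * A := by
  have hsum := summable_bracket_rpow_neg (b := 2 * s - 2) (by linarith)
  have key : ∀ S : Finset ℤ, ∑ k ∈ S, bracket k * ‖a k‖ ≤
      Real.sqrt (∑' k : ℤ, bracket k ^ (-(2 * s - 2))) * A := by
    intro S
    have h0 : 0 ≤ ∑' k : ℤ, bracket k ^ (-(2 * s - 2)) :=
      tsum_nonneg fun k => Real.rpow_nonneg (bracket_pos k).le _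
    -- Cauchy–Schwarz with `⟨k⟩ = ⟨k⟩^{1-s}⟨k⟩^s`; the first factor is square-summable because `2s-2
    -- > 1`.
    have hcs := Finset.sum_mul_sq_le_sq_mul_sq S (fun k => bracket k ^ (1 - s))
      (fun k => bracket k ^ s * ‖a k‖)
    refine (abs_le_of_sq_le_sq' ?_ (mul_nonneg (Real.sqrt_nonneg _) ha.nonneg)).2
    rw [mul_pow, Real.sq_sqrt h0]
    refine le_trans (le_of_eq ?_) (hcs.trans (mul_le_mul ?_ (ha.sum_le S)
      (Finset.sum_nonneg fun _ _ => sq_nonneg _) h0))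
    · congr 1
      refine Finset.sum_congr rfl fun k _ => ?_
      rw [← mul_assoc, ← Real.rpow_add (bracket_pos k)]
      simp
    · refine le_of_eq_of_le (Finset.sum_congr rfl fun k _ => ?_)
        (hsum.sum_le_tsum S fun _ _ => Real.rpow_nonneg (bracket_pos _).le _)
      rw [← Real.rpow_natCast, ← Real.rpow_mul (bracket_pos k).le]
      congr 1
      push_cast
      ring
  have hn : (0 : ℤ → ℝ) ≤ fun k => bracket k * ‖a k‖ := fun k =>
    mul_nonneg (bracket_pos k).le (norm_nonneg _)
  have hs' := summable_of_sum_le hn key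
  exact ⟨hs', hs'.tsum_le_of_sum_le key⟩

lemma summable_norm {s : ℝ} (hs : 3 / 2 < s) {a : ℤ → E} {A : ℝ} (ha : SobBd s a A) :
    Summable fun k => ‖a k‖ :=
  (ha.summable_bracket_mul hs).1.of_nonneg_of_le (fun _ => norm_nonneg _) fun k =>
    le_mul_of_one_le_left (norm_nonneg _) (one_le_bracket k)

end SobBd

/-! ### Trilinear convolution operators -/

/-- The involution of `{(a, b, c) | a + b + c = k}`, parametrized by `(a, b)`, that exchanges `a`
and `c`. -/
def swapFstThd (k : ℤ) : ℤ × ℤ ≃ ℤ × ℤ where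
  toFun p := (k - p.1 - p.2, p.2)
  invFun p := (k - p.1 - p.2, p.2)
  left_inv p := Prod.ext (show k - (k - p.1 - p.2) - p.2 = p.1 by ring) rfl
  right_inv p := Prod.ext (show k - (k - p.1 - p.2) - p.2 = p.1 by ring) rfl

/-- The involution of `{(a, b, c) | a + b + c = k}`, parametrized by `(a, b)`, that exchanges `b`
and `c`. -/
def swapSndThd (k : ℤ) : ℤ × ℤ ≃ ℤ × ℤ where
  toFun p := (p.1, k - p.1 - p.2)
  invFun p := (p.1, k - p.1 - p.2)
  left_inv p := by ext <;> simp
  right_inv p := by ext <;> simp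

section Swap

variable {E : Type*} [AddCommMonoid E] [TopologicalSpace E]

lemma tsum_swap_fst_thd (φ : ℤ → ℤ → ℤ → E) (k : ℤ) :
    ∑' p : ℤ × ℤ, φ (k - p.1 - p.2) p.2 p.1 = ∑' p : ℤ × ℤ, φ p.1 p.2 (k - p.1 - p.2) := by
  rw [← (swapFstThd k).tsum_eq fun p : ℤ × ℤ => φ p.1 p.2 (k - p.1 - p.2)]
  refine tsum_congr fun p => ?_
  simp [swapFstThd, show k - (k - p.1 - p.2) - p.2 = p.1 by ring]

lemma summable_swap_fst_thd (φ : ℤ → ℤ → ℤ → E) (k : ℤ) :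
    (Summable fun p : ℤ × ℤ => φ (k - p.1 - p.2) p.2 p.1) ↔
      Summable fun p : ℤ × ℤ => φ p.1 p.2 (k - p.1 - p.2) := by
  rw [← (swapFstThd k).summable_iff]
  refine iff_of_eq (congrArg (fun f => Summable f) (funext fun p => ?_))
  simp [swapFstThd, show k - (k - p.1 - p.2) - p.2 = p.1 by ring]

lemma tsum_swap_snd_thd (φ : ℤ → ℤ → ℤ → E) (k : ℤ) :
    ∑' p : ℤ × ℤ, φ p.1 (k - p.1 - p.2) p.2 = ∑' p : ℤ × ℤ, φ p.1 p.2 (k - p.1 - p.2) := by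
  rw [← (swapSndThd k).tsum_eq fun p : ℤ × ℤ => φ p.1 p.2 (k - p.1 - p.2)]
  refine tsum_congr fun p => ?_
  simp [swapSndThd]

lemma summable_swap_snd_thd (φ : ℤ → ℤ → ℤ → E) (k : ℤ) :
    (Summable fun p : ℤ × ℤ => φ p.1 (k - p.1 - p.2) p.2) ↔
      Summable fun p : ℤ × ℤ => φ p.1 p.2 (k - p.1 - p.2) := by
  rw [← (swapSndThd k).summable_iff]
  refine iff_of_eq (congrArg (fun f => Summable f) (funext fun p => ?_))
  simp [swapSndThd]

end Swap

lemma SobBd.of_weighted_le {E F : Type*} [SeminormedAddCommGroup E] [SeminormedAddCommGroup F]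
    {s : ℝ} {a : ℤ → E} {b : ℤ → F} {B : ℝ} (h : SobBd 0 b B)
    (hab : ∀ k, bracket k ^ s * ‖a k‖ ≤ ‖b k‖) : SobBd s a B := by
  refine ⟨h.nonneg, fun S => (Finset.sum_le_sum fun k _ => ?_).trans (h.sum_le S)⟩
  have := Real.rpow_nonneg (bracket_pos k).le s
  rw [Real.rpow_zero, one_mul]
  exact pow_le_pow_left₀ (by positivity) (hab k) 2

/-- Young's inequality `ℓ¹ * ℓ¹ * ℓ² ⊆ ℓ²`. -/
lemma SobBd.young {G H X : ℤ → ℝ} {A : ℝ} (hG : Summable G) (hH : Summable H) (hG0 : 0 ≤ G)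
    (hH0 : 0 ≤ H) (hX : SobBd 0 X A) :
    (∀ k, Summable fun p : ℤ × ℤ => G p.1 * H p.2 * X (k - p.1 - p.2)) ∧
      SobBd 0 (fun k => ∑' p : ℤ × ℤ, G p.1 * H p.2 * X (k - p.1 - p.2))
        ((∑' j, G j) * (∑' j, H j) * A) := by
  have hGH : Summable fun p : ℤ × ℤ => G p.1 * H p.2 := hG.mul_of_nonneg hH hG0 hH0
  have hsum : ∀ k, Summable fun p : ℤ × ℤ => G p.1 * H p.2 * X (k - p.1 - p.2) := fun k => by
    refine Summable.of_norm_bounded (hGH.mul_right A) fun p => ?_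
    rw [norm_mul, Real.norm_of_nonneg (mul_nonneg (hG0 _) (hH0 _))]
    exact mul_le_mul_of_nonneg_left (hX.norm_le le_rfl _) (mul_nonneg (hG0 _) (hH0 _))
  refine ⟨hsum, ?_⟩
  have h := SobBd.tsum (s := 0) (a := fun (p : ℤ × ℤ) k => G p.1 * H p.2 * X (k - p.1 - p.2))
    (B := fun p => G p.1 * H p.2 * A) (fun p => ?_) (hGH.mul_right A) hsum
  · rwa [tsum_mul_right, ← hG.tsum_mul_tsum hH hGH] at h
  · refine ((hX.shift p.1).shift p.2).of_norm_le (mul_nonneg (hG0 _) (hH0 _)) fun k => ?_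
    rw [norm_mul, Real.norm_of_nonneg (mul_nonneg (hG0 _) (hH0 _)),
      show k - p.2 - p.1 = k - p.1 - p.2 by ring]

/-- The trilinear convolution
`k ↦ ∑_{k₁ + k₂ + k₃ = k} m(k₁, k₂, k₃) f(k₁) g(k₂) h(k₃)`. -/
def tri (m : ℤ → ℤ → ℤ → ℂ) (f g h : ℤ → ℂ) (k : ℤ) : ℂ :=
  ∑' p : ℤ × ℤ, m p.1 p.2 (k - p.1 - p.2) * (f p.1 * g p.2 * h (k - p.1 - p.2))

/-- The symbols for which trilinear convolution is bounded on `H^s`, `s > 3/2`. -/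
def SymbolBd (m : ℤ → ℤ → ℤ → ℂ) (μ : ℝ) : Prop :=
  ∀ a b c, ‖m a b c‖ ≤ μ * (bracket a * bracket b * bracket c / bracket (a + b + c))

lemma SymbolBd.nonneg {m : ℤ → ℤ → ℤ → ℂ} {μ : ℝ} (h : SymbolBd m μ) : 0 ≤ μ := by
  have := (norm_nonneg _).trans (h 0 0 0)
  simpa [bracket] using this

/-- The norm of trilinear convolution on `H^s` with respect to a symbol `m` with
`SymbolBd m 1`. -/
def triConst (s : ℝ) : ℝ :=
  3 ^ (s - 1) * (3 * Real.sqrt (∑' k : ℤ, bracket k ^ (-(2 * s - 2))) ^ 2)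

lemma triConst_nonneg (s : ℝ) : 0 ≤ triConst s := by unfold triConst; positivity

section Trilinear

variable {s : ℝ} {m : ℤ → ℤ → ℤ → ℂ} {μ : ℝ} {f g h : ℤ → ℂ} {A B C : ℝ}

/-- The symbol turns `⟨k⟩^s` into `⟨k⟩^{s-1}` and puts one bracket on each factor. The remaining
`⟨k⟩^{s-1}` is dominated by the largest of the three frequencies; that factor is then in `ℓ²`, while
the other two, weighted by one bracket, are in `ℓ¹` as `s > 3/2`. Young's inequality concludes. -/
lemma tri_summable_norm_and_sobBd (hs : 3 / 2 < s) (hm : SymbolBd m μ) (hf : SobBd s f A) (hg : SobBd s g B)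
    (hh : SobBd s h C) :
    (∀ k, Summable fun p : ℤ × ℤ =>
        ‖m p.1 p.2 (k - p.1 - p.2) * (f p.1 * g p.2 * h (k - p.1 - p.2))‖) ∧
      SobBd s (tri m f g h) (μ * triConst s * (A * B * C)) := by
  have hμ := hm.nonneg
  obtain ⟨hf1, hf2⟩ := hf.summable_bracket_mul hs
  obtain ⟨hg1, hg2⟩ := hg.summable_bracket_mul hs
  obtain ⟨hh1, hh2⟩ := hh.summable_bracket_mul hs
  set Λ := Real.sqrt (∑' k : ℤ, bracket k ^ (-(2 * s - 2))) with hΛ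
  have hΛ0 : 0 ≤ Λ := Real.sqrt_nonneg _
  set f₁ : ℤ → ℝ := fun k => bracket k * ‖f k‖ with hf₁
  set g₁ : ℤ → ℝ := fun k => bracket k * ‖g k‖ with hg₁
  set h₁ : ℤ → ℝ := fun k => bracket k * ‖h k‖ with hh₁
  have nn : ∀ a : ℤ → ℂ, (0 : ℤ → ℝ) ≤ fun k => bracket k * ‖a k‖ := fun a k =>
    mul_nonneg (bracket_pos k).le (norm_nonneg _)
  have wt : ∀ {a : ℤ → ℂ} {D : ℝ}, SobBd s a D →
      SobBd 0 (fun k => bracket k ^ (s - 1) * (bracket k * ‖a k‖)) D := fun {a D} ha => by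
    refine SobBd.of_norm_le' (SobBd.weight (s := 0) (t := s) (by simpa using ha)) fun k => ?_
    rw [← mul_assoc, ← Real.rpow_add_one (bracket_pos k).ne']
    simp
  -- One application for each factor that may carry `⟨k⟩^{s-1}`. `SobBd.young` has its `ℓ²` factor
  -- in the last slot, so two of the three sums must be reindexed afterwards.
  obtain ⟨S3, Y3⟩ := SobBd.young hf1 hg1 (nn f) (nn g) (wt hh)
  obtain ⟨S1, Y1⟩ := SobBd.young hh1 hg1 (nn h) (nn g) (wt hf)
  obtain ⟨S2, Y2⟩ := SobBd.young hf1 hh1 (nn f) (nn h) (wt hg)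
  have S1' : ∀ k, Summable fun p : ℤ × ℤ =>
      h₁ (k - p.1 - p.2) * g₁ p.2 * (bracket p.1 ^ (s - 1) * f₁ p.1) := fun k =>
    (summable_swap_fst_thd (fun a b c => h₁ a * g₁ b * (bracket c ^ (s - 1) * f₁ c)) k).2 (S1 k)
  have S2' : ∀ k, Summable fun p : ℤ × ℤ =>
      f₁ p.1 * h₁ (k - p.1 - p.2) * (bracket p.2 ^ (s - 1) * g₁ p.2) := fun k =>
    (summable_swap_snd_thd (fun a b c => f₁ a * h₁ b * (bracket c ^ (s - 1) * g₁ c)) k).2 (S2 k)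
  have E1 : ∀ k, ∑' p : ℤ × ℤ, h₁ p.1 * g₁ p.2 * (bracket (k - p.1 - p.2) ^ (s - 1) *
      f₁ (k - p.1 - p.2)) = ∑' p : ℤ × ℤ,
      h₁ (k - p.1 - p.2) * g₁ p.2 * (bracket p.1 ^ (s - 1) * f₁ p.1) := fun k =>
    (tsum_swap_fst_thd (fun a b c => h₁ a * g₁ b * (bracket c ^ (s - 1) * f₁ c)) k).symm
  have E2 : ∀ k, ∑' p : ℤ × ℤ, f₁ p.1 * h₁ p.2 * (bracket (k - p.1 - p.2) ^ (s - 1) *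
      g₁ (k - p.1 - p.2)) = ∑' p : ℤ × ℤ,
      f₁ p.1 * h₁ (k - p.1 - p.2) * (bracket p.2 ^ (s - 1) * g₁ p.2) := fun k =>
    (tsum_swap_snd_thd (fun a b c => f₁ a * h₁ b * (bracket c ^ (s - 1) * g₁ c)) k).symm
  have hY := ((Y1.add Y2).add Y3).of_norm_le (a := fun k => μ * 3 ^ (s - 1) *
    (∑' p : ℤ × ℤ, h₁ p.1 * g₁ p.2 * (bracket (k - p.1 - p.2) ^ (s - 1) * f₁ (k - p.1 - p.2)) +
      ∑' p : ℤ × ℤ, f₁ p.1 * h₁ p.2 * (bracket (k - p.1 - p.2) ^ (s - 1) * g₁ (k - p.1 - p.2)) +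
      ∑' p : ℤ × ℤ, f₁ p.1 * g₁ p.2 * (bracket (k - p.1 - p.2) ^ (s - 1) * h₁ (k - p.1 - p.2))))
    (c := μ * 3 ^ (s - 1)) (by positivity) fun k => by
      rw [norm_mul, Real.norm_of_nonneg (by positivity)]
  have pt : ∀ a b c : ℤ, bracket (a + b + c) ^ s * ‖m a b c * (f a * g b * h c)‖ ≤
      μ * 3 ^ (s - 1) * (h₁ c * g₁ b * (bracket a ^ (s - 1) * f₁ a) +
        f₁ a * h₁ c * (bracket b ^ (s - 1) * g₁ b) +
        f₁ a * g₁ b * (bracket c ^ (s - 1) * h₁ c)) := by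
    intro a b c
    have hk := bracket_pos (a + b + c)
    have h0 := Real.rpow_nonneg hk.le s
    have hp : 0 ≤ f₁ a * g₁ b * h₁ c := mul_nonneg (mul_nonneg (nn f a) (nn g b)) (nn h c)
    calc bracket (a + b + c) ^ s * ‖m a b c * (f a * g b * h c)‖
        = bracket (a + b + c) ^ s * (‖m a b c‖ * (‖f a‖ * ‖g b‖ * ‖h c‖)) := by simp
      _ ≤ bracket (a + b + c) ^ s * ((μ * (bracket a * bracket b * bracket c /
            bracket (a + b + c))) * (‖f a‖ * ‖g b‖ * ‖h c‖)) := by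
          gcongr
          exact hm a b c
      _ = μ * bracket (a + b + c) ^ (s - 1) * (f₁ a * g₁ b * h₁ c) := by
          rw [Real.rpow_sub_one hk.ne']
          simp only [hf₁, hg₁, hh₁]
          ring
      _ ≤ μ * (3 ^ (s - 1) * (bracket a ^ (s - 1) + bracket b ^ (s - 1) + bracket c ^ (s - 1))) *
            (f₁ a * g₁ b * h₁ c) := by
          gcongr
          exact bracket_add_add_rpow_le (by linarith) a b c
      _ = _ := by ring
  have ptk : ∀ (k : ℤ) (p : ℤ × ℤ), bracket k ^ s *
      ‖m p.1 p.2 (k - p.1 - p.2) * (f p.1 * g p.2 * h (k - p.1 - p.2))‖ ≤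
      μ * 3 ^ (s - 1) * (h₁ (k - p.1 - p.2) * g₁ p.2 * (bracket p.1 ^ (s - 1) * f₁ p.1) +
        f₁ p.1 * h₁ (k - p.1 - p.2) * (bracket p.2 ^ (s - 1) * g₁ p.2) +
        f₁ p.1 * g₁ p.2 * (bracket (k - p.1 - p.2) ^ (s - 1) * h₁ (k - p.1 - p.2))) := by
    intro k p
    have := pt p.1 p.2 (k - p.1 - p.2)
    rwa [show p.1 + p.2 + (k - p.1 - p.2) = k by ring] at this
  have hdom : ∀ k, Summable fun p : ℤ × ℤ => μ * 3 ^ (s - 1) *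
      (h₁ (k - p.1 - p.2) * g₁ p.2 * (bracket p.1 ^ (s - 1) * f₁ p.1) +
        f₁ p.1 * h₁ (k - p.1 - p.2) * (bracket p.2 ^ (s - 1) * g₁ p.2) +
        f₁ p.1 * g₁ p.2 * (bracket (k - p.1 - p.2) ^ (s - 1) * h₁ (k - p.1 - p.2))) := fun k =>
    (((S1' k).add (S2' k)).add (S3 k)).mul_left _
  have hsum : ∀ k, Summable fun p : ℤ × ℤ =>
      ‖m p.1 p.2 (k - p.1 - p.2) * (f p.1 * g p.2 * h (k - p.1 - p.2))‖ := fun k =>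
    (hdom k).of_nonneg_of_le (fun p => norm_nonneg _) fun p =>
      le_trans (le_mul_of_one_le_left (norm_nonneg _) (one_le_bracket_rpow (by linarith) k))
        (ptk k p)
  refine ⟨hsum, (hY.of_weighted_le fun k => ?_).mono ?_⟩
  · calc bracket k ^ s * ‖tri m f g h k‖
        ≤ bracket k ^ s * ∑' p : ℤ × ℤ,
            ‖m p.1 p.2 (k - p.1 - p.2) * (f p.1 * g p.2 * h (k - p.1 - p.2))‖ :=
          mul_le_mul_of_nonneg_left (norm_tsum_le_tsum_norm (hsum k))
            (Real.rpow_nonneg (bracket_pos k).le _)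
      _ = ∑' p : ℤ × ℤ, bracket k ^ s *
            ‖m p.1 p.2 (k - p.1 - p.2) * (f p.1 * g p.2 * h (k - p.1 - p.2))‖ :=
          tsum_mul_left.symm
      _ ≤ _ := ((hsum k).mul_left _).tsum_le_tsum (ptk k) (hdom k)
      _ = _ := by
          rw [tsum_mul_left, ((S1' k).add (S2' k)).tsum_add (S3 k), (S1' k).tsum_add (S2' k),
            ← E1, ← E2]
      _ ≤ _ := le_abs_self _
  · have t1 : (∑' j, h₁ j) * (∑' j, g₁ j) * A ≤ Λ * C * (Λ * B) * A :=
      mul_le_mul_of_nonneg_right (mul_le_mul hh2 hg2 (tsum_nonneg (nn g))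
        (mul_nonneg hΛ0 hh.nonneg)) hf.nonneg
    have t2 : (∑' j, f₁ j) * (∑' j, h₁ j) * B ≤ Λ * A * (Λ * C) * B :=
      mul_le_mul_of_nonneg_right (mul_le_mul hf2 hh2 (tsum_nonneg (nn h))
        (mul_nonneg hΛ0 hf.nonneg)) hg.nonneg
    have t3 : (∑' j, f₁ j) * (∑' j, g₁ j) * C ≤ Λ * A * (Λ * B) * C :=
      mul_le_mul_of_nonneg_right (mul_le_mul hf2 hg2 (tsum_nonneg (nn g))
        (mul_nonneg hΛ0 hf.nonneg)) hh.nonneg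
    calc μ * 3 ^ (s - 1) * (_ + _ + _)
        ≤ μ * 3 ^ (s - 1) * (Λ * C * (Λ * B) * A + Λ * A * (Λ * C) * B + Λ * A * (Λ * B) * C) := by
          gcongr
      _ = _ := by
          rw [triConst, ← hΛ]
          ring

lemma tri_summable_norm (hs : 3 / 2 < s) (hm : SymbolBd m μ) (hf : SobBd s f A) (hg : SobBd s g B)
    (hh : SobBd s h C) (k : ℤ) : Summable fun p : ℤ × ℤ =>
      ‖m p.1 p.2 (k - p.1 - p.2) * (f p.1 * g p.2 * h (k - p.1 - p.2))‖ :=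
  (tri_summable_norm_and_sobBd hs hm hf hg hh).1 k

lemma tri_summable (hs : 3 / 2 < s) (hm : SymbolBd m μ) (hf : SobBd s f A) (hg : SobBd s g B)
    (hh : SobBd s h C) (k : ℤ) : Summable fun p : ℤ × ℤ =>
      m p.1 p.2 (k - p.1 - p.2) * (f p.1 * g p.2 * h (k - p.1 - p.2)) :=
  (tri_summable_norm hs hm hf hg hh k).of_norm

lemma SobBd.tri (hs : 3 / 2 < s) (hm : SymbolBd m μ) (hf : SobBd s f A) (hg : SobBd s g B)
    (hh : SobBd s h C) : SobBd s (tri m f g h) (μ * triConst s * (A * B * C)) :=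
  (tri_summable_norm_and_sobBd hs hm hf hg hh).2

/-- The Fourier coefficients of `f̄`, when those of `f` are given by `a`. -/
def conjSeq (a : ℤ → ℂ) (k : ℤ) : ℂ := conj (a (-k))

lemma SobBd.conjSeq (hf : SobBd s f A) : SobBd s (conjSeq f) A := by
  refine ⟨hf.nonneg, fun S => ?_⟩
  have := hf.sum_le (S.map (Equiv.neg ℤ).toEmbedding)
  simpa [CubicNLS.conjSeq, bracket_neg] using this

/-- The cubic operator `k ↦ ∑_{k₁ + k₂ + k₃ = k} m(k₁, k₂, k₃) f̄(k₁) f(k₂) f(k₃)`, where the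
factor with index `k₁` is the Fourier coefficient of the complex conjugate. -/
def cub (m : ℤ → ℤ → ℤ → ℂ) (f : ℤ → ℂ) : ℤ → ℂ := tri m (conjSeq f) f f

lemma SobBd.cub (hs : 3 / 2 < s) (hm : SymbolBd m μ) (hf : SobBd s f A) :
    SobBd s (cub m f) (μ * triConst s * (A * A * A)) :=
  SobBd.tri hs hm hf.conjSeq hf hf

lemma cub_summable (hs : 3 / 2 < s) (hm : SymbolBd m μ) (hf : SobBd s f A) (k : ℤ) :
    Summable fun p : ℤ × ℤ =>
      m p.1 p.2 (k - p.1 - p.2) * (conjSeq f p.1 * f p.2 * f (k - p.1 - p.2)) :=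
  tri_summable hs hm hf.conjSeq hf hf k

/-- `cub m` is Lipschitz on bounded sets of `H^s`. -/
lemma SobBd.cub_sub (hs : 3 / 2 < s) (hm : SymbolBd m μ) (hf : SobBd s f A) (hg : SobBd s g A)
    (hfg : SobBd s (fun k => f k - g k) B) :
    SobBd s (fun k => CubicNLS.cub m f k - CubicNLS.cub m g k)
      (3 * μ * triConst s * A ^ 2 * B) := by
  -- The difference telescopes, one factor being replaced at a time.
  have hc : SobBd s (fun k => CubicNLS.conjSeq f k - CubicNLS.conjSeq g k) B :=
    hfg.conjSeq.of_norm_le' fun k => by simp [CubicNLS.conjSeq]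
  have h1 := SobBd.tri hs hm hc hf hf
  have h2 := SobBd.tri hs hm hg.conjSeq hfg hf
  have h3 := SobBd.tri hs hm hg.conjSeq hg hfg
  refine (((h1.add h2).add h3).of_norm_le' fun k => le_of_eq ?_).mono (le_of_eq (by ring))
  congr 1
  simp only [CubicNLS.tri, CubicNLS.cub]
  rw [← (tri_summable hs hm hc hf hf k).tsum_add (tri_summable hs hm hg.conjSeq hfg hf k),
    ← ((tri_summable hs hm hc hf hf k).add (tri_summable hs hm hg.conjSeq hfg hf k)).tsum_add
      (tri_summable hs hm hg.conjSeq hg hfg k),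
    ← (tri_summable hs hm hf.conjSeq hf hf k).tsum_sub (tri_summable hs hm hg.conjSeq hg hg k)]
  exact tsum_congr fun p => by ring

end Trilinear

/-- The two unconjugated factors are the same sequence, so a symbol matters only up to
symmetrization in its last two arguments. -/
lemma cub_congr_of_swap {m m' : ℤ → ℤ → ℤ → ℂ} (f : ℤ → ℂ) (h : ∀ a b c, m' a b c = m a c b) :
    cub m' f = cub m f := by
  funext k
  have := tsum_swap_snd_thd (fun a b c => m a b c * (conjSeq f a * f b * f c)) k
  simp only [cub, tri, h]
  rw [← this]
  exact tsum_congr fun p => by ring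

/-! ### Solutions on the Fourier side and their conservation laws -/

/-- Mean value inequality for weighted `ℓ²` sequences that are differentiable componentwise. -/
lemma SobBd.mean_value {s : ℝ} {D D' : ℝ → ℤ → ℂ} {B a b : ℝ} (hab : a ≤ b) (hB : 0 ≤ B)
    (hc : ∀ k, ContinuousOn (fun t => D t k) (Set.Icc a b))
    (hd : ∀ t ∈ Set.Ioo a b, ∀ k, HasDerivAt (fun t => D t k) (D' t k) t)
    (hD : ∀ t ∈ Set.Ioo a b, SobBd s (D' t) B) :
    SobBd s (fun k => D b k - D a k) (B * (b - a)) := by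
  refine ⟨mul_nonneg hB (by linarith), fun S => ?_⟩
  rcases hab.eq_or_lt with rfl | hab
  · simp
  set δ : ℤ → ℂ := fun k => D b k - D a k with hδ
  set X := ∑ k ∈ S, (bracket k ^ s * ‖δ k‖) ^ 2 with hX
  have hX0 : 0 ≤ X := Finset.sum_nonneg fun _ _ => sq_nonneg _
  -- The scalar mean value theorem is applied to the weighted pairing of `D t` with the fixed
  -- increment `δ` over `S`. Its slope is `X / (b - a)`, and Cauchy–Schwarz bounds its derivative by
  -- `√X · B`. Finite sums make componentwise derivatives enough.
  obtain ⟨t, ht, hslope⟩ := exists_hasDerivAt_eq_slope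
    (fun t => ∑ k ∈ S, (bracket k ^ s) ^ 2 * (conj (δ k) * D t k).re)
    (fun t => ∑ k ∈ S, (bracket k ^ s) ^ 2 * (conj (δ k) * D' t k).re) hab
    (continuousOn_finsetSum _ fun k _ => continuousOn_const.mul
      (Complex.continuous_re.comp_continuousOn (continuousOn_const.mul (hc k))))
    (fun t ht => HasDerivAt.fun_sum fun k _ => HasDerivAt.const_mul _
      (Complex.reCLM.hasFDerivAt.comp_hasDerivAt t ((hd t ht k).const_mul _)))
  have hba : 0 < b - a := sub_pos.2 hab
  have h1 : X = (∑ k ∈ S, (bracket k ^ s) ^ 2 * (conj (δ k) * D' t k).re) * (b - a) := by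
    rw [hslope, div_mul_cancel₀ _ hba.ne', ← Finset.sum_sub_distrib, hX]
    refine Finset.sum_congr rfl fun k _ => ?_
    rw [← mul_sub, ← Complex.sub_re, ← mul_sub, mul_pow, mul_comm (conj (δ k)),
      show D b k - D a k = δ k from rfl, Complex.mul_conj, Complex.normSq_eq_norm_sq]
    simp only [Complex.ofReal_re]
  have h2 : ∑ k ∈ S, (bracket k ^ s) ^ 2 * (conj (δ k) * D' t k).re ≤ Real.sqrt X * B := by
    have hcs := Finset.sum_mul_sq_le_sq_mul_sq S (fun k => bracket k ^ s * ‖δ k‖)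
      (fun k => bracket k ^ s * ‖D' t k‖)
    calc _ ≤ ∑ k ∈ S, bracket k ^ s * ‖δ k‖ * (bracket k ^ s * ‖D' t k‖) := by
          refine Finset.sum_le_sum fun k _ => ?_
          calc (bracket k ^ s) ^ 2 * (conj (δ k) * D' t k).re
              ≤ (bracket k ^ s) ^ 2 * (‖δ k‖ * ‖D' t k‖) := by
                refine mul_le_mul_of_nonneg_left ?_ (sq_nonneg _)
                refine (Complex.re_le_norm _).trans (le_of_eq ?_)
                rw [norm_mul, Complex.norm_conj]
            _ = _ := by ring
      _ ≤ _ := by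
          refine (abs_le_of_sq_le_sq' ?_ (mul_nonneg (Real.sqrt_nonneg _) hB)).2
          rw [mul_pow, Real.sq_sqrt hX0]
          exact hcs.trans (mul_le_mul_of_nonneg_left ((hD t ht).sum_le S) hX0)
  have h3 : X ≤ Real.sqrt X * (B * (b - a)) := by
    calc X ≤ Real.sqrt X * B * (b - a) := by
          rw [h1] at *
          exact mul_le_mul_of_nonneg_right h2 hba.le
      _ = _ := by ring
  have h4 := Real.sq_sqrt hX0
  have h5 : Real.sqrt X ≤ B * (b - a) := by
    by_contra! hlt
    have := Real.sqrt_nonneg X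
    have h6 : 0 ≤ B * (b - a) := mul_nonneg hB hba.le
    nlinarith
  calc X = Real.sqrt X ^ 2 := h4.symm
    _ ≤ _ := pow_le_pow_left₀ (Real.sqrt_nonneg _) h5 2

/-- A bounded solution of the cubic NLS, in terms of its Fourier coefficients. -/
structure SeqSol (γ T R : ℝ) (c : ℝ → ℤ → ℂ) : Prop where
  bound : ∀ t ∈ Set.Icc 0 T, SobBd γ (c t) R
  cont : ∀ k, ContinuousOn (fun t => c t k) (Set.Icc 0 T)
  deriv : ∀ t ∈ Set.Ioo 0 T, ∀ k : ℤ, HasDerivAt (fun t => c t k)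
    (-Complex.I * ((k : ℂ) ^ 2 * c t k + cub (fun _ _ _ => 1) (c t) k)) t

lemma SymbolBd.of_mul_le {m : ℤ → ℤ → ℤ → ℂ} {μ : ℝ}
    (h : ∀ a b c, ‖m a b c‖ * bracket (a + b + c) ≤ μ * (bracket a * bracket b * bracket c)) :
    SymbolBd m μ := fun a b c => by
  rw [← mul_div_assoc, le_div_iff₀ (bracket_pos _)]
  exact h a b c

lemma bracket_le_mul_mul (a b c : ℤ) :
    bracket a ≤ bracket a * bracket b * bracket c ∧ bracket b ≤ bracket a * bracket b * bracket c ∧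
      bracket c ≤ bracket a * bracket b * bracket c := by
  have ha := one_le_bracket a
  have hb := one_le_bracket b
  have hc := one_le_bracket c
  have hab : 1 ≤ bracket a * bracket b := one_le_mul_of_one_le_of_one_le ha hb
  have hbc : 1 ≤ bracket b * bracket c := one_le_mul_of_one_le_of_one_le hb hc
  have hac : 1 ≤ bracket a * bracket c := one_le_mul_of_one_le_of_one_le ha hc
  refine ⟨by nlinarith, by nlinarith, by nlinarith⟩

/-- By the triangle inequality `⟨a+b+c⟩ ≤ ⟨a⟩+⟨b⟩+⟨c⟩`, and each summand is at most the product
since brackets are at least `1`. -/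
lemma SymbolBd.of_norm_le_one {m : ℤ → ℤ → ℤ → ℂ} (h : ∀ a b c, ‖m a b c‖ ≤ 1) :
    SymbolBd m 3 := by
  refine .of_mul_le fun a b c => ?_
  obtain ⟨h1, h2, h3⟩ := bracket_le_mul_mul a b c
  have h4 := bracket_add_le (a + b) c
  have h5 := bracket_add_le a b
  calc _ ≤ 1 * bracket (a + b + c) :=
        mul_le_mul_of_nonneg_right (h a b c) (bracket_pos _).le
    _ ≤ _ := by linarith

/-! ### Conservation of mass and momentum -/

section Conservation

variable {γ : ℝ} {w : ℤ → ℂ} {R : ℝ} {α : ℤ → ℝ}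

lemma SobBd.sum_mul_le {s : ℝ} {a b : ℤ → ℂ} {A B : ℝ} (ha : SobBd s a A) (hb : SobBd s b B)
    (S : Finset ℤ) :
    ∑ k ∈ S, (bracket k ^ s * ‖a k‖) * (bracket k ^ s * ‖b k‖) ≤ A * B := by
  refine (abs_le_of_sq_le_sq' ?_ (mul_nonneg ha.nonneg hb.nonneg)).2
  rw [mul_pow]
  exact (Finset.sum_mul_sq_le_sq_mul_sq S _ _).trans (mul_le_mul (ha.sum_le S) (hb.sum_le S)
    (Finset.sum_nonneg fun _ _ => sq_nonneg _) (sq_nonneg _))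

/-- The gauge and translation invariance of the cubic nonlinearity: for an additive weight `α`, the
sum `∑ₖ αₖ w̄ₖ N(w)ₖ` is real. -/
lemma im_tsum_conj_mul_cub (hγ : 3 / 2 < γ) (hw : SobBd γ w R) (hα : ∀ k, |α k| ≤ bracket k)
    (hadd : ∀ a b c d, a + b = c + d → α a + α b = α c + α d) :
    (Summable fun k => (α k : ℂ) * (conj (w k) * cub (fun _ _ _ => 1) w k)) ∧
      (∑' k, (α k : ℂ) * (conj (w k) * cub (fun _ _ _ => 1) w k)).im = 0 := by
  -- With `q = (k, a, b)` and `c = k-a-b`, the quartic term is `w̄_k w̄_{-a} w_b w_c`, and `k + (-a)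
  -- = b + c`.
  set G : ℤ × ℤ × ℤ → ℂ := fun q =>
    conj (w q.1) * (conj (w (-q.2.1)) * w q.2.2 * w (q.1 - q.2.1 - q.2.2)) with hG
  have hwt := (hw.summable_bracket_mul hγ).1
  have hn := hw.summable_norm hγ
  have hnc := hw.conjSeq.summable_norm hγ
  have hdom : Summable fun q : ℤ × ℤ × ℤ =>
      bracket q.1 * ‖w q.1‖ * (‖conjSeq w q.2.1‖ * ‖w q.2.2‖) :=
    hwt.mul_of_nonneg (hnc.mul_of_nonneg hn (fun _ => norm_nonneg _) fun _ => norm_nonneg _)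
      (fun k => mul_nonneg (bracket_pos k).le (norm_nonneg _))
      fun p => mul_nonneg (norm_nonneg _) (norm_nonneg _)
  have hsum : Summable fun q : ℤ × ℤ × ℤ => (α q.1 : ℂ) * G q := by
    refine Summable.of_norm_bounded (hdom.mul_right R) fun q => ?_
    have e1 : ‖(α q.1 : ℂ) * G q‖ = |α q.1| * ‖w q.1‖ * (‖conjSeq w q.2.1‖ * ‖w q.2.2‖) *
        ‖w (q.1 - q.2.1 - q.2.2)‖ := by
      simp only [hG, conjSeq, norm_mul, Complex.norm_conj, Complex.norm_real, Real.norm_eq_abs]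
      ring
    rw [e1]
    have := hα q.1
    have := hw.norm_le (by linarith) (q.1 - q.2.1 - q.2.2)
    have := bracket_pos q.1
    gcongr
  have hfib : ∀ k, ∑' p : ℤ × ℤ, (α k : ℂ) * G (k, p) =
      (α k : ℂ) * (conj (w k) * cub (fun _ _ _ => 1) w k) := fun k => by
    rw [tsum_mul_left]
    simp only [hG]
    rw [tsum_mul_left]
    simp [cub, tri, conjSeq]
  have hS : ∑' k, (α k : ℂ) * (conj (w k) * cub (fun _ _ _ => 1) w k) =
      ∑' q : ℤ × ℤ × ℤ, (α q.1 : ℂ) * G q := by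
    rw [hsum.tsum_prod]
    exact tsum_congr fun k => (hfib k).symm
  refine ⟨(hsum.prod).congr hfib, ?_⟩
  -- The symmetries of the quartic form: `ysw` exchanges `k` with `-a`, `xsw` exchanges `b` with
  -- `c`, and `xy` exchanges the pair `(k, -a)` with `(b, c)`, which conjugates `G`.
  let ysw : ℤ × ℤ × ℤ ≃ ℤ × ℤ × ℤ :=
    { toFun := fun q => (-q.2.1, -q.1, q.2.2)
      invFun := fun q => (-q.2.1, -q.1, q.2.2)
      left_inv := fun q => by simp
      right_inv := fun q => by simp }
  let xsw : ℤ × ℤ × ℤ ≃ ℤ × ℤ × ℤ :=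
    { toFun := fun q => (q.1, q.2.1, q.1 - q.2.1 - q.2.2)
      invFun := fun q => (q.1, q.2.1, q.1 - q.2.1 - q.2.2)
      left_inv := fun q => by simp
      right_inv := fun q => by simp }
  let xy : ℤ × ℤ × ℤ ≃ ℤ × ℤ × ℤ :=
    { toFun := fun q => (q.2.2, -(q.1 - q.2.1 - q.2.2), q.1)
      invFun := fun q => (q.2.2, -(q.1 - q.2.1 - q.2.2), q.1)
      left_inv := fun q => Prod.ext rfl (Prod.ext
        (show -(q.2.2 - -(q.1 - q.2.1 - q.2.2) - q.1) = q.2.1 by ring) rfl)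
      right_inv := fun q => Prod.ext rfl (Prod.ext
        (show -(q.2.2 - -(q.1 - q.2.1 - q.2.2) - q.1) = q.2.1 by ring) rfl) }
  have Gysw : ∀ q, G (ysw q) = G q := fun q => by
    simp only [hG, ysw, Equiv.coe_fn_mk, neg_neg,
      show -q.2.1 - -q.1 - q.2.2 = q.1 - q.2.1 - q.2.2 by ring]
    ring
  have Gxsw : ∀ q, G (xsw q) = G q := fun q => by
    simp only [hG, xsw, Equiv.coe_fn_mk,
      show q.1 - q.2.1 - (q.1 - q.2.1 - q.2.2) = q.2.2 by ring]
    ring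
  have Gxy : ∀ q, G (xy q) = conj (G q) := fun q => by
    simp only [hG, xy, Equiv.coe_fn_mk, neg_neg, map_mul, Complex.conj_conj,
      show q.2.2 - -(q.1 - q.2.1 - q.2.2) - q.1 = -q.2.1 by ring]
    ring
  set Z := ∑' q : ℤ × ℤ × ℤ, (α q.1 : ℂ) * G q with hZ
  have s1 : Summable fun q : ℤ × ℤ × ℤ => (α (-q.2.1) : ℂ) * G q := by
    refine (ysw.summable_iff.2 hsum).congr fun q => ?_
    simp only [Function.comp, Gysw]
    rfl
  have z1 : ∑' q : ℤ × ℤ × ℤ, (α (-q.2.1) : ℂ) * G q = Z := by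
    rw [hZ, ← ysw.tsum_eq fun q : ℤ × ℤ × ℤ => (α q.1 : ℂ) * G q]
    refine tsum_congr fun q => ?_
    rw [Gysw]
    rfl
  have s2 : Summable fun q : ℤ × ℤ × ℤ => (α q.2.2 : ℂ) * conj (G q) := by
    refine (xy.summable_iff.2 hsum).congr fun q => ?_
    simp only [Function.comp, Gxy]
    rfl
  have z2 : ∑' q : ℤ × ℤ × ℤ, (α q.2.2 : ℂ) * conj (G q) = Z := by
    rw [hZ, ← xy.tsum_eq fun q : ℤ × ℤ × ℤ => (α q.1 : ℂ) * G q]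
    refine tsum_congr fun q => ?_
    rw [Gxy]
    rfl
  have z3 : ∑' q : ℤ × ℤ × ℤ, (α q.2.2 : ℂ) * G q = conj Z := by
    rw [← z2, Complex.conj_tsum]
    exact tsum_congr fun q => by simp
  have s3 : Summable fun q : ℤ × ℤ × ℤ => (α q.2.2 : ℂ) * G q := by
    refine (Complex.summable_conj.2 s2).congr fun q => by simp
  have s4 : Summable fun q : ℤ × ℤ × ℤ => (α (q.1 - q.2.1 - q.2.2) : ℂ) * G q := by
    refine (xsw.summable_iff.2 s3).congr fun q => ?_
    simp only [Function.comp, Gxsw]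
    rfl
  have z4 : ∑' q : ℤ × ℤ × ℤ, (α (q.1 - q.2.1 - q.2.2) : ℂ) * G q = conj Z := by
    rw [← z3, ← xsw.tsum_eq fun q : ℤ × ℤ × ℤ => (α q.2.2 : ℂ) * G q]
    refine tsum_congr fun q => ?_
    rw [Gxsw]
    rfl
  -- By the symmetries, weighting `G` with `α` at `k` or `-a` gives `Z`, and at `b` or `c` gives
  -- `conj Z`. Additivity of `α` equates the two pair sums.
  have hfin : Z + Z = conj Z + conj Z := by
    nth_rewrite 2 [← z1]
    nth_rewrite 1 [← z3]
    rw [← z4, hZ, ← hsum.tsum_add s1, ← s3.tsum_add s4]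
    refine tsum_congr fun q => ?_
    rw [← add_mul, ← add_mul]
    congr 1
    exact_mod_cast hadd _ _ _ _ (by ring)
  have him := congrArg Complex.im hfin
  simp only [Complex.add_im, Complex.conj_im] at him
  rw [hS]
  linarith

/-- `∑ₖ αₖ |wₖ|²`. -/
def quadForm (α : ℤ → ℝ) (w : ℤ → ℂ) : ℝ := ∑' k, α k * ‖w k‖ ^ 2

lemma quadForm_summable (hγ : 3 / 2 < γ) (hw : SobBd γ w R) (hα : ∀ k, |α k| ≤ bracket k) :
    Summable fun k => α k * ‖w k‖ ^ 2 := by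
  refine Summable.of_norm_bounded ((hw.summable_bracket_mul hγ).1.mul_right R) fun k => ?_
  rw [norm_mul, Real.norm_eq_abs, norm_pow, norm_norm, sq, ← mul_assoc]
  have := hα k
  have := hw.norm_le (by linarith) k
  have := bracket_pos k
  gcongr

lemma abs_quadForm_le (hγ : 3 / 2 < γ) (hw : SobBd γ w R) (hα : ∀ k, |α k| ≤ bracket k) :
    |quadForm α w| ≤ Real.sqrt (∑' k : ℤ, bracket k ^ (-(2 * γ - 2))) * R ^ 2 := by
  obtain ⟨h1, h2⟩ := hw.summable_bracket_mul hγ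
  calc |quadForm α w| ≤ ∑' k, bracket k * ‖w k‖ * R := by
        refine (tsum_of_norm_bounded (h1.mul_right R).hasSum fun k => ?_ : ‖quadForm α w‖ ≤ _)
        rw [norm_mul, Real.norm_eq_abs, norm_pow, norm_norm, sq, ← mul_assoc]
        have := hα k
        have := hw.norm_le (by linarith) k
        have := bracket_pos k
        gcongr
    _ ≤ _ := by
        rw [tsum_mul_right, sq, ← mul_assoc]
        exact mul_le_mul_of_nonneg_right h2 hw.nonneg

/-- The full sum vanishes, so the partial sum is minus its tail. On the tail `|k| > n`, so `|α k| ·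
n ≤ ⟨k⟩² ≤ ⟨k⟩^{2γ}`, and Cauchy–Schwarz in `H^γ` leaves a factor `1/n`. -/
lemma abs_sum_im_conj_mul_cub_le (hγ : 3 / 2 < γ) (hw : SobBd γ w R)
    (hα : ∀ k, |α k| ≤ bracket k) (hadd : ∀ a b c d, a + b = c + d → α a + α b = α c + α d)
    {n : ℕ} (hn : 0 < n) {S : Finset ℤ} (hS : Finset.Icc (-(n : ℤ)) n ⊆ S) :
    |∑ k ∈ S, α k * (conj (w k) * cub (fun _ _ _ => 1) w k).im| ≤
      R * (3 * triConst γ * (R * R * R)) / n := by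
  obtain ⟨h1, h2⟩ := im_tsum_conj_mul_cub hγ hw hα hadd
  have hN : SobBd γ (cub (fun _ _ _ => 1) w) (3 * triConst γ * (R * R * R)) :=
    SobBd.cub hγ (.of_norm_le_one fun _ _ _ => by simp) hw
  have hn' : (0 : ℝ) < n := by exact_mod_cast hn
  set d : ℤ → ℝ := fun k => α k * (conj (w k) * cub (fun _ _ _ => 1) w k).im with hd
  have hds : HasSum d 0 := by
    have := Complex.hasSum_im h1.hasSum
    rw [h2] at this
    exact this.congr_fun fun k => by simp [hd]
  have htail : Tendsto (fun S' => ∑ k ∈ S', d k - ∑ k ∈ S, d k) atTop (𝓝 (0 - ∑ k ∈ S, d k)) :=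
    Tendsto.sub_const hds _
  rw [← abs_neg, ← zero_sub]
  refine le_of_tendsto htail.abs ?_
  filter_upwards [eventually_ge_atTop S] with S' hSS'
  rw [← Finset.sum_sdiff hSS', add_sub_cancel_right]
  refine (Finset.abs_sum_le_sum_abs _ _).trans ?_
  rw [le_div_iff₀ hn', Finset.sum_mul]
  refine le_trans (Finset.sum_le_sum fun k hk => ?_) (hw.sum_mul_le hN (S' \ S))
  have hkn : (n : ℝ) ≤ bracket k := by
    refine le_trans ?_ (abs_le_bracket k)
    have hk' : k ∉ Finset.Icc (-(n : ℤ)) n := fun h => (Finset.mem_sdiff.1 hk).2 (hS h)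
    rw [Finset.mem_Icc, ← abs_le, not_le] at hk'
    exact_mod_cast hk'.le
  have hb : bracket k ≤ bracket k ^ γ := by
    simpa using Real.rpow_le_rpow_of_exponent_le (one_le_bracket k) (by linarith : (1 : ℝ) ≤ γ)
  have hb0 := bracket_pos k
  calc |d k| * n ≤ (bracket k * (‖w k‖ * ‖cub (fun _ _ _ => 1) w k‖)) * bracket k := by
        rw [hd, abs_mul]
        gcongr
        · exact hα k
        · refine (Complex.abs_im_le_norm _).trans (le_of_eq ?_)
          rw [norm_mul, Complex.norm_conj]
    _ = (bracket k * ‖w k‖) * (bracket k * ‖cub (fun _ _ _ => 1) w k‖) := by ring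
    _ ≤ _ := by gcongr

/-- Conservation of mass and momentum. -/
lemma SeqSol.quadForm_eq {T : ℝ} {c : ℝ → ℤ → ℂ} (hγ : 3 / 2 < γ) (hc : SeqSol γ T R c)
    (hα : ∀ k, |α k| ≤ bracket k) (hadd : ∀ a b c d, a + b = c + d → α a + α b = α c + α d)
    {t : ℝ} (ht : t ∈ Set.Icc 0 T) : quadForm α (c t) = quadForm α (c 0) := by
  rcases ht.1.eq_or_lt with rfl | ht0
  · rfl
  have h0 : (0 : ℝ) ∈ Set.Icc 0 T := ⟨le_rfl, ht.1.trans ht.2⟩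
  set K := R * (3 * triConst γ * (R * R * R)) with hK
  -- Differentiating the infinite sum is avoided: the truncated quantity has derivative `O(1/n)`
  -- uniformly in time, as the dispersive term `-ik²` drops out of the real part. The truncation is
  -- then removed.
  have key : ∀ n : ℕ, 0 < n → |quadForm α (c t) - quadForm α (c 0)| ≤ 2 * K / n * t := by
    intro n hn
    have hlim := ((quadForm_summable hγ (hc.bound t ht) hα).hasSum.sub
      (quadForm_summable hγ (hc.bound 0 h0) hα).hasSum).abs
    refine le_of_tendsto hlim ?_
    filter_upwards [eventually_ge_atTop (Finset.Icc (-(n : ℤ)) n)] with S hS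
    obtain ⟨r, hr, hslope⟩ := exists_hasDerivAt_eq_slope
      (fun r => ∑ k ∈ S, α k * ‖c r k‖ ^ 2)
      (fun r => ∑ k ∈ S, α k * (2 * (conj (c r k) * cub (fun _ _ _ => 1) (c r) k).im)) ht0
      (continuousOn_finsetSum _ fun k _ => continuousOn_const.mul
        (((hc.cont k).mono (Set.Icc_subset_Icc_right ht.2)).norm.pow 2))
      (fun r hr => HasDerivAt.fun_sum fun k _ => HasDerivAt.const_mul _ (by
        refine (hc.deriv r ⟨hr.1, hr.2.trans_le ht.2⟩ k).norm_sq.congr_deriv ?_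
        rw [Complex.inner]
        simp only [Complex.mul_im, Complex.mul_re, Complex.conj_re, Complex.conj_im,
          Complex.neg_re, Complex.neg_im, Complex.I_re, Complex.I_im, Complex.add_re,
          Complex.add_im, sq, Complex.intCast_re, Complex.intCast_im]
        ring))
    have hb := abs_sum_im_conj_mul_cub_le hγ (hc.bound r ⟨hr.1.le, hr.2.le.trans ht.2⟩) hα hadd
      hn hS
    have he : ∑ k ∈ S, (α k * ‖c t k‖ ^ 2 - α k * ‖c 0 k‖ ^ 2) =
        2 * (∑ k ∈ S, α k * (conj (c r k) * cub (fun _ _ _ => 1) (c r) k).im) * t := by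
      rw [Finset.sum_sub_distrib, Finset.mul_sum]
      rw [sub_zero, eq_div_iff ht0.ne'] at hslope
      rw [← hslope]
      congr 1
      exact Finset.sum_congr rfl fun k _ => by ring
    rw [he, abs_mul, abs_mul, abs_of_pos ht0, abs_of_pos (two_pos : (0 : ℝ) < 2), mul_div_assoc]
    gcongr
  have hlim : Tendsto (fun n : ℕ => 2 * K / n * t) atTop (𝓝 0) := by
    simpa using (tendsto_const_div_atTop_nhds_zero_nat (2 * K)).mul_const t
  have := ge_of_tendsto hlim ((eventually_gt_atTop 0).mono fun n hn => key n hn)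
  exact sub_eq_zero.1 (abs_eq_zero.1 (le_antisymm this (abs_nonneg _)))

end Conservation

/-! ### The integrator on the Fourier side -/

/-- `e^{ix}` for real `x`. -/
def cis (x : ℝ) : ℂ := Complex.exp (Complex.I * x)

lemma norm_cis (x : ℝ) : ‖cis x‖ = 1 := by rw [cis, Complex.norm_exp_I_mul_ofReal]

lemma norm_cis_sub_one_le (x : ℝ) : ‖cis x - 1‖ ≤ |x| := Real.norm_exp_I_mul_ofReal_sub_one_le

lemma cis_zero : cis 0 = 1 := by simp [cis]

lemma cis_add (x y : ℝ) : cis (x + y) = cis x * cis y := by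
  simp only [cis, Complex.ofReal_add, mul_add, Complex.exp_add]

lemma conj_cis (x : ℝ) : conj (cis x) = cis (-x) := by
  simp [cis, ← Complex.exp_conj]

lemma norm_cis_sub_cis_le (x y : ℝ) : ‖cis x - cis y‖ ≤ |x - y| := by
  have : cis x - cis y = cis y * (cis (x - y) - 1) := by
    rw [mul_sub, ← cis_add, mul_one, add_sub_cancel]
  rw [this, norm_mul, norm_cis, one_mul]
  exact norm_cis_sub_one_le _

lemma hasDerivAt_cis_mul (x s : ℝ) :
    HasDerivAt (fun s : ℝ => cis (s * x)) (Complex.I * x * cis (s * x)) s := by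
  have h : HasDerivAt (fun s : ℝ => Complex.I * ((s * x : ℝ) : ℂ)) (Complex.I * x) s := by
    have := ((hasDerivAt_id s).mul_const x).ofReal_comp.const_mul Complex.I
    simpa using this
  refine h.cexp.congr_deriv ?_
  rw [cis]
  ring

/-- The resonance function `k² + k₁² - k₂² - k₃²`, where `k = k₁ + k₂ + k₃`. -/
def phase (a b c : ℤ) : ℝ := 2 * (a + b) * (a + c)

/-- The phase `k² + k₁² - (k - k₁)²`. -/
def lowPhase (a b c : ℤ) : ℝ := 2 * (a + b + c) * a

/-- The symbol of the cubic terms of the integrator with step size `s`, in the interaction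
picture. -/
def stepSymbol (s : ℝ) (a b c : ℤ) : ℂ :=
  if a + b + c = 0 then -(Complex.I * s) else
    (cis (s * lowPhase a b c) - 1) / (2 * ((a + b + c : ℤ) : ℂ) ^ 2) +
      if a + b = 0 then 0 else
        -((cis (s * phase a b c) - 1) / (((a + b + c : ℤ) : ℂ) * ((a + b : ℤ) : ℂ)))

/-- The derivative of `stepSymbol s` in `s`. -/
def stepSymbolDeriv (s : ℝ) (a b c : ℤ) : ℂ :=
  if a + b + c = 0 then -Complex.I else
    Complex.I * (a / ((a + b + c : ℤ) : ℂ)) * cis (s * lowPhase a b c) +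
      if a + b = 0 then 0 else
        -(2 * Complex.I * (((a + c : ℤ) : ℂ) / ((a + b + c : ℤ) : ℂ)) * cis (s * phase a b c))

/-- The resonant part `k₁ + k₂ = 0`. -/
def resSymbol (a b c : ℤ) : ℂ :=
  if a + b + c = 0 then 0 else
    if a + b = 0 then 2 * Complex.I * (((a + c : ℤ) : ℂ) / ((a + b + c : ℤ) : ℂ)) else 0

/-- The error that is made in the symbol of the cubic term. -/
def errSymbol (s : ℝ) (a b c : ℤ) : ℂ :=
  if a + b + c = 0 then -Complex.I * (1 - cis (s * phase a b c)) else
    Complex.I * (a / ((a + b + c : ℤ) : ℂ)) * (cis (s * lowPhase a b c) - cis (s * phase a b c))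

/-! ### Bounds and derivatives of the symbols -/

section Symbols

lemma abs_intCast_add_le (a c : ℤ) : |((a + c : ℤ) : ℝ)| ≤ |(a : ℝ)| + |(c : ℝ)| := by
  push_cast
  exact abs_add_le _ _

/-- A bound of the form `|k| ‖m‖ ≤ μ ⟨k₁⟩⟨k₂⟩⟨k₃⟩` for `k ≠ 0` and `‖m‖ ≤ μ ⟨k₁⟩⟨k₂⟩⟨k₃⟩` for `k = 0`
yields a symbol bound. -/
lemma SymbolBd.of_abs_mul_le {m : ℤ → ℤ → ℤ → ℂ} {μ : ℝ}
    (h0 : ∀ a b c, a + b + c = 0 → ‖m a b c‖ ≤ 2 * μ * (bracket a * bracket b * bracket c))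
    (h1 : ∀ a b c, a + b + c ≠ 0 →
      |((a + b + c : ℤ) : ℝ)| * ‖m a b c‖ ≤ μ * (bracket a * bracket b * bracket c)) :
    SymbolBd m (2 * μ) := by
  refine .of_mul_le fun a b c => ?_
  by_cases hk : a + b + c = 0
  · have : bracket (a + b + c) = 1 := by simp [hk, bracket]
    rw [this, mul_one]
    exact h0 a b c hk
  · have := h1 a b c hk
    calc ‖m a b c‖ * bracket (a + b + c) ≤ ‖m a b c‖ * (2 * |((a + b + c : ℤ) : ℝ)|) :=
          mul_le_mul_of_nonneg_left (bracket_le_two_mul_abs hk) (norm_nonneg _)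
      _ ≤ _ := by linarith

lemma norm_intCast (a : ℤ) : ‖(a : ℂ)‖ = |(a : ℝ)| := by
  rw [Complex.norm_intCast]

lemma one_le_bracket_mul_mul (a b c : ℤ) : 1 ≤ bracket a * bracket b * bracket c :=
  (one_le_bracket a).trans (bracket_le_mul_mul a b c).1

lemma abs_mul_abs_le_bracket_mul_mul (a b c : ℤ) :
    |(b : ℝ)| * |(c : ℝ)| ≤ bracket a * bracket b * bracket c := by
  have h2 := abs_le_bracket b
  have h3 := abs_le_bracket c
  calc |(b : ℝ)| * |(c : ℝ)| = 1 * |(b : ℝ)| * |(c : ℝ)| := by ring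
    _ ≤ _ := by
      gcongr
      · exact mul_nonneg (bracket_pos a).le (bracket_pos b).le
      · exact (bracket_pos a).le
      · exact one_le_bracket a

lemma abs_add_two_mul_abs_add_le (a b c : ℤ) :
    |(a : ℝ)| + 2 * |((a + c : ℤ) : ℝ)| ≤ 5 * (bracket a * bracket b * bracket c) := by
  obtain ⟨h1, -, h3⟩ := bracket_le_mul_mul a b c
  linarith [abs_intCast_add_le a c, abs_le_bracket a, abs_le_bracket c]

/-- By `|e^{ix} - 1| ≤ |x|`, the phase `2ka` cancels one factor `k` of `2k²`, and the phase
`2(a+b)(a+c)` cancels `a+b`. For `k ≠ 0` this leaves `|s|(|a| + 2|a+c|)/|k|`. Linearity in `|s|` is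
what stability needs. -/
lemma symbolBd_stepSymbol (s : ℝ) : SymbolBd (stepSymbol s) (2 * (5 * |s|)) := by
  refine .of_abs_mul_le (fun a b c hk => ?_) fun a b c hk => ?_
  · have := one_le_bracket_mul_mul a b c
    rw [stepSymbol, if_pos hk, norm_neg, norm_mul, Complex.norm_I, one_mul, Complex.norm_real,
      Real.norm_eq_abs]
    nlinarith [abs_nonneg s]
  · rw [stepSymbol, if_neg hk]
    set k := a + b + c with hkdef
    have hk' : 0 < |(k : ℝ)| := abs_pos.2 (by exact_mod_cast hk)
    have e1 : |(k : ℝ)| * ‖(cis (s * lowPhase a b c) - 1) / (2 * (k : ℂ) ^ 2)‖ ≤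
        |s| * |(a : ℝ)| := by
      have hl : |s * lowPhase a b c| = 2 * |s| * |(k : ℝ)| * |(a : ℝ)| := by
        have : s * lowPhase a b c = 2 * s * k * a := by
          rw [lowPhase, hkdef]
          push_cast
          ring
        rw [this, abs_mul, abs_mul, abs_mul, abs_two]
      have hc := norm_cis_sub_one_le (s * lowPhase a b c)
      rw [norm_div, norm_mul, norm_pow, norm_intCast, Complex.norm_ofNat, ← mul_div_assoc,
        div_le_iff₀ (by positivity)]
      calc _ ≤ |(k : ℝ)| * (2 * |s| * |(k : ℝ)| * |(a : ℝ)|) := by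
            rw [← hl]
            gcongr
        _ = _ := by ring
    have e2 : |(k : ℝ)| * ‖if a + b = 0 then (0 : ℂ) else
        -((cis (s * phase a b c) - 1) / ((k : ℂ) * ((a + b : ℤ) : ℂ)))‖ ≤
        |s| * (2 * |((a + c : ℤ) : ℝ)|) := by
      split_ifs with hab
      · simp only [norm_zero, mul_zero]
        positivity
      · have hab' : 0 < |((a + b : ℤ) : ℝ)| := abs_pos.2 (by exact_mod_cast hab)
        have hl : |s * phase a b c| = 2 * |s| * |((a + b : ℤ) : ℝ)| * |((a + c : ℤ) : ℝ)| := by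
          have : s * phase a b c = 2 * s * ((a + b : ℤ) : ℝ) * ((a + c : ℤ) : ℝ) := by
            rw [phase]
            push_cast
            ring
          rw [this, abs_mul, abs_mul, abs_mul, abs_two]
        have hc := norm_cis_sub_one_le (s * phase a b c)
        rw [norm_neg, norm_div, norm_mul, norm_intCast, norm_intCast, ← mul_div_assoc,
          div_le_iff₀ (by positivity)]
        calc _ ≤ |(k : ℝ)| * (2 * |s| * |((a + b : ℤ) : ℝ)| * |((a + c : ℤ) : ℝ)|) := by
              rw [← hl]
              gcongr
          _ = _ := by ring
    have := abs_add_two_mul_abs_add_le a b c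
    calc _ ≤ |(k : ℝ)| * (‖(cis (s * lowPhase a b c) - 1) / (2 * (k : ℂ) ^ 2)‖ +
          ‖if a + b = 0 then (0 : ℂ) else
            -((cis (s * phase a b c) - 1) / ((k : ℂ) * ((a + b : ℤ) : ℂ)))‖) := by
          gcongr
          exact norm_add_le _ _
      _ ≤ |s| * (|(a : ℝ)| + 2 * |((a + c : ℤ) : ℝ)|) := by linarith
      _ ≤ |s| * (5 * (bracket a * bracket b * bracket c)) := by gcongr
      _ = _ := by ring

lemma symbolBd_resSymbol : SymbolBd resSymbol (2 * 5) := by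
  refine .of_abs_mul_le (fun a b c hk => ?_) fun a b c hk => ?_
  · have := one_le_bracket_mul_mul a b c
    rw [resSymbol, if_pos hk, norm_zero]
    linarith
  · have h := abs_add_two_mul_abs_add_le a b c
    have h' := one_le_bracket_mul_mul a b c
    have hk' : 0 < |((a + b + c : ℤ) : ℝ)| := abs_pos.2 (by exact_mod_cast hk)
    rw [resSymbol, if_neg hk]
    split_ifs
    · rw [norm_mul, norm_mul, norm_div, norm_intCast, norm_intCast, Complex.norm_I,
        Complex.norm_ofNat]
      field_simp
      linarith [abs_nonneg (a : ℝ)]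
    · rw [norm_zero, mul_zero]
      linarith

lemma symbolBd_stepSymbolDeriv (s : ℝ) : SymbolBd (stepSymbolDeriv s) (2 * 5) := by
  refine .of_abs_mul_le (fun a b c hk => ?_) fun a b c hk => ?_
  · have := one_le_bracket_mul_mul a b c
    rw [stepSymbolDeriv, if_pos hk, norm_neg, Complex.norm_I]
    linarith
  · have h := abs_add_two_mul_abs_add_le a b c
    have hk' : 0 < |((a + b + c : ℤ) : ℝ)| := abs_pos.2 (by exact_mod_cast hk)
    rw [stepSymbolDeriv, if_neg hk]
    set k := a + b + c with hkdef
    have e1 : ‖Complex.I * (a / (k : ℂ)) * cis (s * lowPhase a b c)‖ = |(a : ℝ)| / |(k : ℝ)| := by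
      rw [norm_mul, norm_mul, norm_cis, norm_div, norm_intCast, norm_intCast, Complex.norm_I]
      ring
    have e2 : ‖if a + b = 0 then (0 : ℂ) else
        -(2 * Complex.I * (((a + c : ℤ) : ℂ) / (k : ℂ)) * cis (s * phase a b c))‖ ≤
        2 * |((a + c : ℤ) : ℝ)| / |(k : ℝ)| := by
      split_ifs
      · rw [norm_zero]
        positivity
      · rw [norm_neg, norm_mul, norm_mul, norm_mul, norm_cis, norm_div, norm_intCast, norm_intCast,
          Complex.norm_I, Complex.norm_ofNat]
        apply le_of_eq
        ring
    calc _ ≤ |(k : ℝ)| * (|(a : ℝ)| / |(k : ℝ)| + 2 * |((a + c : ℤ) : ℝ)| / |(k : ℝ)|) := by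
          gcongr
          exact (norm_add_le _ _).trans (by linarith)
      _ = |(a : ℝ)| + 2 * |((a + c : ℤ) : ℝ)| := by field_simp
      _ ≤ _ := h

lemma phase_eq (a b c : ℤ) : phase a b c = lowPhase a b c + 2 * (b * c) := by
  rw [phase, lowPhase]
  ring

/-- The two phases differ by `2bc`, or `φ` itself equals `2bc` when `k = 0`. The derivatives thus
fall on separate factors, as the symbol class permits. -/
lemma symbolBd_errSymbol (s : ℝ) : SymbolBd (errSymbol s) (2 * (2 * |s|)) := by
  refine .of_abs_mul_le (fun a b c hk => ?_) fun a b c hk => ?_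
  · have h := abs_mul_abs_le_bracket_mul_mul a b c
    have hp : phase a b c = 2 * (b * c) := by
      have : (a : ℝ) + b + c = 0 := by exact_mod_cast hk
      rw [phase_eq, lowPhase, this]
      ring
    rw [errSymbol, if_pos hk, norm_mul, norm_neg, Complex.norm_I, one_mul, norm_sub_rev]
    calc _ ≤ |s * phase a b c| := norm_cis_sub_one_le _
      _ = 2 * |s| * (|(b : ℝ)| * |(c : ℝ)|) := by
          rw [hp, abs_mul, abs_mul, abs_mul, abs_two]
          ring
      _ ≤ 2 * |s| * (bracket a * bracket b * bracket c) := by gcongr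
      _ ≤ _ := by nlinarith [abs_nonneg s, one_le_bracket_mul_mul a b c]
  · have hk' : 0 < |((a + b + c : ℤ) : ℝ)| := abs_pos.2 (by exact_mod_cast hk)
    rw [errSymbol, if_neg hk, norm_mul, norm_mul, norm_div, norm_intCast, norm_intCast,
      Complex.norm_I, one_mul]
    have h1 : ‖cis (s * lowPhase a b c) - cis (s * phase a b c)‖ ≤
        2 * |s| * (|(b : ℝ)| * |(c : ℝ)|) := by
      refine (norm_cis_sub_cis_le _ _).trans (le_of_eq ?_)
      rw [phase_eq, abs_sub_comm, ← mul_sub, add_sub_cancel_left, abs_mul, abs_mul, abs_mul,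
        abs_two]
      ring
    calc _ = |(a : ℝ)| * ‖cis (s * lowPhase a b c) - cis (s * phase a b c)‖ := by field_simp
      _ ≤ bracket a * (2 * |s| * (bracket b * bracket c)) := by
          refine mul_le_mul (abs_le_bracket a) (h1.trans ?_) (norm_nonneg _) (bracket_pos a).le
          have := abs_le_bracket b
          have := abs_le_bracket c
          have := bracket_pos b
          gcongr
      _ = _ := by ring

lemma hasDerivAt_stepSymbol (a b c : ℤ) (s : ℝ) :
    HasDerivAt (fun s => stepSymbol s a b c) (stepSymbolDeriv s a b c) s := by
  simp only [stepSymbol, stepSymbolDeriv]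
  by_cases hk : a + b + c = 0
  · simp only [if_pos hk]
    simpa using ((hasDerivAt_id s).ofReal_comp.const_mul Complex.I).fun_neg
  · simp only [if_neg hk]
    have hk' : ((a + b + c : ℤ) : ℂ) ≠ 0 := by exact_mod_cast hk
    refine HasDerivAt.add ?_ ?_
    · refine (((hasDerivAt_cis_mul (lowPhase a b c) s).sub_const 1).div_const _).congr_deriv ?_
      rw [lowPhase]
      field_simp
      push_cast
      ring
    · by_cases hab : a + b = 0
      · simp only [if_pos hab]
        exact hasDerivAt_const _ _
      · simp only [if_neg hab]
        have hab' : ((a + b : ℤ) : ℂ) ≠ 0 := by exact_mod_cast hab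
        refine (((hasDerivAt_cis_mul (phase a b c) s).sub_const 1).div_const _).neg.congr_deriv ?_
        rw [phase]
        field_simp
        push_cast
        ring

end Symbols

/-! ### Local error, stability and convergence on the Fourier side -/

section Step

variable {γ T R : ℝ} {w : ℤ → ℂ} {c : ℝ → ℤ → ℂ}

/-- The symbol `2m - 2p/k` of the phase correction for mass `m` and momentum `-ip`. -/
def corr (m p : ℝ) (k : ℤ) : ℝ := 2 * m - 2 * p / k

/-- One step of the integrator in terms of Fourier coefficients. -/
def stepSeq (s m p : ℝ) (w : ℤ → ℂ) (k : ℤ) : ℂ :=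
  cis (s * -(k : ℝ) ^ 2) * (cis (s * -corr m p k) * w k +
    (if k = 0 then 2 * Complex.I * s * m * w 0 else 0) + cub (stepSymbol s) w k)

lemma cub_add_apply (hγ : 3 / 2 < γ) {m m' : ℤ → ℤ → ℤ → ℂ} {μ μ' : ℝ} (hm : SymbolBd m μ)
    (hm' : SymbolBd m' μ') (hw : SobBd γ w R) (k : ℤ) :
    cub (fun a b c => m a b c + m' a b c) w k = cub m w k + cub m' w k := by
  have := (cub_summable hγ hm hw k).tsum_add (cub_summable hγ hm' hw k)
  rw [cub, tri, cub, tri, cub, tri, ← this]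
  exact tsum_congr fun p => by ring

lemma cub_const_mul (z : ℂ) (m : ℤ → ℤ → ℤ → ℂ) (w : ℤ → ℂ) (k : ℤ) :
    cub (fun a b c => z * m a b c) w k = z * cub m w k := by
  rw [cub, tri, cub, tri, ← tsum_mul_left]
  exact tsum_congr fun p => by ring

lemma cub_congr {m m' : ℤ → ℤ → ℤ → ℂ} (w : ℤ → ℂ) (k : ℤ)
    (h : ∀ a b c, a + b + c = k → m a b c = m' a b c) : cub m w k = cub m' w k :=
  tsum_congr fun p => by rw [h _ _ _ (by ring)]

lemma symbolBd_cis_phase (s : ℝ) : SymbolBd (fun a b c => cis (s * phase a b c)) 3 :=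
  .of_norm_le_one fun _ _ _ => (norm_cis _).le

/-- Passage to the interaction picture: the free phases at the four frequencies combine to the
resonance function. -/
lemma cis_mul_cub (s : ℝ) (w : ℤ → ℂ) (k : ℤ) :
    cis (s * (k : ℝ) ^ 2) * cub (fun _ _ _ => 1) w k =
      cub (fun a b c => cis (s * phase a b c)) (fun j => cis (s * (j : ℝ) ^ 2) * w j) k := by
  rw [cub, tri, cub, tri, ← tsum_mul_left]
  refine tsum_congr fun q => ?_
  obtain ⟨a, b⟩ := q
  simp only [conjSeq, map_mul, conj_cis]
  have : cis (s * (k : ℝ) ^ 2) = cis (s * phase a b (k - a - b)) *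
      (cis (-(s * ((-a : ℤ) : ℝ) ^ 2)) * cis (s * (b : ℝ) ^ 2) *
        cis (s * ((k - a - b : ℤ) : ℝ) ^ 2)) := by
    rw [← cis_add, ← cis_add, ← cis_add]
    congr 1
    rw [phase]
    push_cast
    ring
  rw [this]
  ring

/-- The resonant part of the cubic term is linear up to the mass and the momentum. -/
lemma cub_resSymbol (hγ : 3 / 2 < γ) (hw : SobBd γ w R) (k : ℤ) :
    cub resSymbol w k = if k = 0 then 0 else
      Complex.I * (corr (quadForm (fun _ => 1) w) (quadForm (fun j => (j : ℝ)) w) k) * w k := by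
  by_cases hk : k = 0
  · rw [if_pos hk, cub, tri]
    refine (tsum_congr fun p => ?_).trans tsum_zero
    rw [resSymbol, if_pos (by rw [hk]; ring), zero_mul]
  rw [if_neg hk, cub, tri]
  have hk' : (k : ℂ) ≠ 0 := by exact_mod_cast hk
  have hinj : Function.Injective fun j : ℤ => ((-j, j) : ℤ × ℤ) := fun i j h =>
    (Prod.ext_iff.1 h).2
  have hm := quadForm_summable hγ hw (α := fun _ => 1) fun k => by simpa using one_le_bracket k
  have hp := quadForm_summable hγ hw (α := fun j => (j : ℝ)) abs_le_bracket
  -- The sum is supported on the line `(a, b) = (-j, j)`, where `c = k` and the symbol is `2i(1 -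
  -- j/k)`; the two terms produce mass and momentum.
  rw [← hinj.tsum_eq]
  · have : ∀ j : ℤ, resSymbol (-j) j (k - -j - j) *
        (conjSeq w (-j) * w j * w (k - -j - j)) = Complex.I *
          ((2 * (1 * ‖w j‖ ^ 2) - 2 * (j * ‖w j‖ ^ 2) / k : ℝ) : ℂ) * w k := fun j => by
      rw [show k - -j - j = k by ring, resSymbol, if_neg (by simpa using hk), if_pos (by ring),
        conjSeq, neg_neg, mul_comm (conj (w j)), Complex.mul_conj, Complex.normSq_eq_norm_sq,
        show -j + j + k = k by ring]
      push_cast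
      field_simp
      ring
    simp only [this]
    rw [tsum_mul_right, tsum_mul_left, ← Complex.ofReal_tsum,
      ((hm.mul_left 2).tsum_sub ((hp.mul_left 2).div_const _)), tsum_div_const]
    simp only [corr, quadForm, tsum_mul_left]
  · intro q hq
    by_contra hne
    apply hq
    have : q.1 + q.2 ≠ 0 := fun h => hne ⟨q.2, Prod.ext (by simp; linarith) rfl⟩
    simp [resSymbol, this]

/-- The decomposition of the symbol of the cubic term: the exact nonlinearity, the resonant linear
part, and a remainder that is small without any loss of derivatives. -/
lemma cub_stepSymbolDeriv (hγ : 3 / 2 < γ) (hw : SobBd γ w R) (s : ℝ) (k : ℤ) :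
    cub (stepSymbolDeriv s) w k = -Complex.I * cub (fun a b c => cis (s * phase a b c)) w k +
      cub (errSymbol s) w k + cub resSymbol w k := by
  set e : ℤ → ℤ → ℤ → ℂ := fun a b c => cis (s * phase a b c) with he
  have hB := symbolBd_stepSymbolDeriv s
  have hr := symbolBd_resSymbol
  have hneg : SymbolBd (fun a b c => -1 * resSymbol a b c) (2 * 5) := fun a b c => by
    simpa using hr a b c
  -- Subtracting the resonant symbol removes the case distinction at `a + b = 0`: the phase vanishes
  -- there, so the subtracted value continues the nonresonant formula.
  set n : ℤ → ℤ → ℤ → ℂ := fun a b c => stepSymbolDeriv s a b c + -1 * resSymbol a b c with hn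
  have hnB : SymbolBd n (2 * 5 + 2 * 5) := fun a b c => by
    rw [add_mul]
    exact (norm_add_le _ _).trans (add_le_add (hB a b c) (hneg a b c))
  have hnB' : SymbolBd (fun a b c => n a c b) (2 * 5 + 2 * 5) := fun a b c => by
    have := hnB a c b
    rwa [show a + c + b = a + b + c by ring, mul_right_comm (bracket a)] at this
  have h1 : cub n w k = cub (stepSymbolDeriv s) w k + -1 * cub resSymbol w k := by
    rw [hn, cub_add_apply hγ hB hneg hw, cub_const_mul]
  have h2 : cub (fun a b c => n a c b) w k = cub n w k :=
    congrFun (cub_congr_of_swap w fun _ _ _ => rfl) k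
  have h3 : cub (fun a b c => n a b c + n a c b) w k = cub n w k + cub n w k := by
    rw [cub_add_apply hγ hnB hnB' hw, h2]
  have hee : SymbolBd (fun a b c => -Complex.I * e a b c) 3 := fun a b c => by
    simpa using symbolBd_cis_phase s a b c
  have h4 : cub (fun a b c => 2 * (-Complex.I * e a b c + errSymbol s a b c)) w k =
      2 * (-Complex.I * cub e w k + cub (errSymbol s) w k) := by
    rw [cub_const_mul, cub_add_apply hγ hee (symbolBd_errSymbol s) hw, cub_const_mul]
  have h5 : cub (fun a b c => n a b c + n a c b) w k =
      cub (fun a b c => 2 * (-Complex.I * e a b c + errSymbol s a b c)) w k := by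
    refine cub_congr w k fun a b c habc => ?_
    have hn1 : ∀ a b c, a + b + c = k → n a b c = if k = 0 then -Complex.I else
        Complex.I * (a / (k : ℂ)) * cis (s * lowPhase a b c) -
          2 * Complex.I * (((a + c : ℤ) : ℂ) / (k : ℂ)) * e a b c := fun a b c habc => by
      simp only [hn, stepSymbolDeriv, resSymbol, habc, he]
      split_ifs with hk hab
      · ring
      · have : phase a b c = 0 := by
          have : (a : ℝ) + b = 0 := by exact_mod_cast hab
          rw [phase, this]
          ring
        rw [this, mul_zero, cis_zero]
        ring
      · ring
    have e1 : e a c b = e a b c := by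
      simp only [he, phase]
      ring_nf
    have e2 : lowPhase a c b = lowPhase a b c := by
      rw [lowPhase, lowPhase]
      ring
    rw [hn1 a b c habc, hn1 a c b (by rw [← habc]; ring), e1, e2, errSymbol, habc]
    split_ifs with hk
    · ring
    · have hk' : (k : ℂ) ≠ 0 := by exact_mod_cast hk
      have hs : (k : ℂ) = a + b + c := by rw [← habc]; push_cast; ring
      -- The identity `(a+b)/k + (a+c)/k = 1 + a/k`, which produces the exact nonlinearity after
      -- symmetrization.
      have : (((a + c : ℤ) : ℂ) / (k : ℂ)) + (((a + b : ℤ) : ℂ) / (k : ℂ)) = 1 + a / (k : ℂ) := by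
        field_simp
        rw [hs]
        push_cast
        ring
      linear_combination (-2 * Complex.I * e a b c) * this
  have h6 : 2 * (cub (stepSymbolDeriv s) w k + -1 * cub resSymbol w k) =
      2 * (-Complex.I * cub e w k + cub (errSymbol s) w k) := by
    rw [← h4, ← h5, h3, h1]
    ring
  linear_combination h6 / 2

/-- Termwise differentiation is justified because the bound on the differentiated symbol is uniform
in `s` and is itself an admissible symbol, here `β`, giving a summable majorant. -/
lemma hasDerivAt_cub_stepSymbol (hγ : 3 / 2 < γ) (hw : SobBd γ w R) (s : ℝ) (k : ℤ) :
    HasDerivAt (fun s => cub (stepSymbol s) w k) (cub (stepSymbolDeriv s) w k) s := by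
  let β : ℤ → ℤ → ℤ → ℂ := fun a b c =>
    ((2 * 5 * (bracket a * bracket b * bracket c / bracket (a + b + c)) : ℝ) : ℂ)
  have hβn : ∀ a b c, ‖β a b c‖ =
      2 * 5 * (bracket a * bracket b * bracket c / bracket (a + b + c)) := fun a b c => by
    have h1 := bracket_pos a
    have h2 := bracket_pos b
    have h3 := bracket_pos c
    have h4 := bracket_pos (a + b + c)
    rw [Complex.norm_real, Real.norm_of_nonneg (by positivity)]
  have hβ : SymbolBd β (2 * 5) := fun a b c => (hβn a b c).le
  refine hasDerivAt_tsum
    (g := fun (p : ℤ × ℤ) s => stepSymbol s p.1 p.2 (k - p.1 - p.2) *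
      (conjSeq w p.1 * w p.2 * w (k - p.1 - p.2)))
    (g' := fun (p : ℤ × ℤ) s => stepSymbolDeriv s p.1 p.2 (k - p.1 - p.2) *
      (conjSeq w p.1 * w p.2 * w (k - p.1 - p.2)))
    (tri_summable_norm hγ hβ hw.conjSeq hw hw k)
    (fun p s => (hasDerivAt_stepSymbol _ _ _ s).mul_const _) (fun p s => ?_)
    (cub_summable hγ (symbolBd_stepSymbol 0) hw k) s
  rw [norm_mul, norm_mul (β _ _ _), hβn]
  exact mul_le_mul_of_nonneg_right (symbolBd_stepSymbolDeriv s _ _ _) (norm_nonneg _)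

lemma abs_corr_le (hγ : 3 / 2 < γ) (hw : SobBd γ w R) (k : ℤ) :
    |corr (quadForm (fun _ => 1) w) (quadForm (fun j => (j : ℝ)) w) k| ≤
      4 * (Real.sqrt (∑' k : ℤ, bracket k ^ (-(2 * γ - 2))) * R ^ 2) := by
  have hm := abs_quadForm_le hγ hw (α := fun _ => 1) fun k => by simpa using one_le_bracket k
  have hp := abs_quadForm_le hγ hw (α := fun j => (j : ℝ)) abs_le_bracket
  set m := quadForm (fun _ => 1) w
  set p := quadForm (fun j => (j : ℝ)) w
  have h1 : |2 * p / k| ≤ 2 * |p| := by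
    rw [abs_div, abs_mul, abs_two]
    by_cases hk : k = 0
    · simp [hk]
    · exact div_le_self (by positivity) (by exact_mod_cast Int.one_le_abs hk)
  calc |corr m p k| ≤ |2 * m| + |2 * p / k| := abs_sub _ _
    _ ≤ _ := by
      rw [abs_mul, abs_two]
      linarith

/-- The constant in the local error estimate. -/
def localConst (γ R : ℝ) : ℝ :=
  3 * 3 * triConst γ * R ^ 2 * (3 * triConst γ * (R * R * R)) +
    (4 * (Real.sqrt (∑' k : ℤ, bracket k ^ (-(2 * γ - 2))) * R ^ 2)) ^ 2 * R +
    4 * triConst γ * (R * R * R)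

/-- The local error of the integrator is of second order in `H^γ`. -/
lemma SeqSol.local_error (hγ : 3 / 2 < γ) (hc : SeqSol γ T R c) {t₀ τ : ℝ} (ht₀ : 0 ≤ t₀)
    (hτ : 0 ≤ τ) (hT : t₀ + τ ≤ T) :
    SobBd γ (fun k => c (t₀ + τ) k - stepSeq τ (quadForm (fun _ => 1) (c t₀))
      (quadForm (fun j => (j : ℝ)) (c t₀)) (c t₀) k) (localConst γ R * τ ^ 2) := by
  set w := c t₀ with hwdef
  set m := quadForm (fun _ => 1) w with hm
  set p := quadForm (fun j => (j : ℝ)) w with hp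
  have hw : SobBd γ w R := hc.bound t₀ ⟨ht₀, by linarith⟩
  have hR := hw.nonneg
  have ht3 := triConst_nonneg γ
  set v : ℝ → ℤ → ℂ := fun s k => cis (s * (k : ℝ) ^ 2) * c (t₀ + s) k with hv
  set e : ℝ → ℤ → ℤ → ℤ → ℂ := fun s a b c => cis (s * phase a b c) with he
  have hmem : ∀ s ∈ Set.Icc 0 τ, t₀ + s ∈ Set.Icc 0 T := fun s hs =>
    ⟨by linarith [hs.1], by linarith [hs.2]⟩
  have hvB : ∀ s ∈ Set.Icc 0 τ, SobBd γ (v s) R := fun s hs =>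
    (hc.bound _ (hmem s hs)).of_norm_le' fun k => by simp [hv, norm_cis]
  have hvc : ∀ k, ContinuousOn (fun s => v s k) (Set.Icc 0 τ) := fun k => by
    refine ContinuousOn.mul (fun s _ => ?_) ?_
    · exact (hasDerivAt_cis_mul _ s).continuousAt.continuousWithinAt
    · exact (hc.cont k).comp (by fun_prop) hmem
  have hvd : ∀ s ∈ Set.Ioo 0 τ, ∀ k, HasDerivAt (fun s => v s k)
      (-Complex.I * cub (e s) (v s) k) s := fun s hs k => by
    have h1 := (hc.deriv (t₀ + s) ⟨by linarith [hs.1], by linarith [hs.2]⟩ k).comp_const_add t₀ s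
    refine ((hasDerivAt_cis_mul ((k : ℝ) ^ 2) s).mul h1).congr_deriv ?_
    simp only [he, hv]
    rw [← cis_mul_cub]
    push_cast
    ring
  -- In the interaction picture the derivative is bounded in `H^γ` without loss, so `v` moves by
  -- only `O(s)`.
  have hvw : ∀ s ∈ Set.Icc 0 τ, SobBd γ (fun k => v s k - w k)
      (3 * triConst γ * (R * R * R) * s) := fun s hs => by
    have := SobBd.mean_value (s := γ) (D := v) (D' := fun s k => -Complex.I * cub (e s) (v s) k)
      (B := 3 * triConst γ * (R * R * R)) hs.1 (by positivity)
      (fun k => (hvc k).mono (Set.Icc_subset_Icc_right hs.2))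
      (fun r hr => hvd r ⟨hr.1, hr.2.trans_le hs.2⟩) fun r hr =>
        (SobBd.cub hγ (symbolBd_cis_phase r)
          (hvB r ⟨hr.1.le, hr.2.le.trans hs.2⟩)).of_norm_le' fun k => by simp [he]
    simpa [hv, cis_zero, hwdef] using this
  set D : ℝ → ℤ → ℂ := fun s k => v s k - (cis (s * -corr m p k) * w k +
    (if k = 0 then 2 * Complex.I * s * m * w 0 else 0) + cub (stepSymbol s) w k) with hD
  -- The three terms are the effect of freezing `v`, of exponentiating the resonant linear term, and
  -- of modifying the phase. Each is `O(s)`, and `localConst` lists their constants in this order.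
  set D' : ℝ → ℤ → ℂ := fun s k => -Complex.I * (cub (e s) (v s) k - cub (e s) w k) +
    Complex.I * corr m p k * (cis (s * -corr m p k) - 1) * w k + -cub (errSymbol s) w k with hD'
  have hlin : ∀ (s : ℝ) (k : ℤ), HasDerivAt (fun s : ℝ => cis (s * -corr m p k) * w k +
      (if k = 0 then 2 * Complex.I * s * m * w 0 else 0) + cub (stepSymbol s) w k)
      (-Complex.I * corr m p k * cis (s * -corr m p k) * w k +
        (if k = 0 then 2 * Complex.I * m * w 0 else 0) + cub (stepSymbolDeriv s) w k) s := by
    intro s k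
    refine HasDerivAt.add (HasDerivAt.add ?_ ?_) (hasDerivAt_cub_stepSymbol hγ hw s k)
    · refine ((hasDerivAt_cis_mul (-corr m p k) s).mul_const (w k)).congr_deriv ?_
      push_cast
      ring
    · by_cases hk : k = 0
      · simp only [if_pos hk]
        have := ((((hasDerivAt_id s).ofReal_comp.const_mul (2 * Complex.I)).mul_const
          (m : ℂ)).mul_const (w 0))
        simpa using this
      · simp only [if_neg hk]
        exact hasDerivAt_const _ _
  have hDd : ∀ s ∈ Set.Ioo 0 τ, ∀ k, HasDerivAt (fun s => D s k) (D' s k) s := fun s hs k => by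
    refine ((hvd s hs k).sub (hlin s k)).congr_deriv ?_
    rw [cub_stepSymbolDeriv hγ hw, cub_resSymbol hγ hw]
    simp only [hD']
    rw [← hm, ← hp]
    by_cases hk : k = 0
    · simp only [hk, if_true]
      -- Division by zero gives `0` here. The zero mode has no resonant term in `resSymbol`, and the
      -- extra term `2ismw₀` of the step offsets the factor `2m` of the exponential to first order.
      have : corr m p 0 = 2 * m := by simp [corr]
      rw [this]
      push_cast
      ring
    · simp only [if_neg hk]
      ring
  have hDc : ∀ k, ContinuousOn (fun s => D s k) (Set.Icc 0 τ) := fun k =>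
    (hvc k).sub fun s _ => (hlin s k).continuousAt.continuousWithinAt
  have hDB : ∀ s ∈ Set.Ioo 0 τ, SobBd γ (D' s) (localConst γ R * τ) := fun s hs => by
    have hs' : s ∈ Set.Icc 0 τ := ⟨hs.1.le, hs.2.le⟩
    have b1 : SobBd γ (fun k => -Complex.I * (cub (e s) (v s) k - cub (e s) w k)) _ :=
      (SobBd.cub_sub hγ (symbolBd_cis_phase s) (hvB s hs') hw (hvw s hs')).of_norm_le'
        fun k => by simp [he]
    set Λ := 4 * (Real.sqrt (∑' k : ℤ, bracket k ^ (-(2 * γ - 2))) * R ^ 2) with hΛ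
    have b2 : SobBd γ (fun k => Complex.I * corr m p k * (cis (s * -corr m p k) - 1) * w k)
        (Λ ^ 2 * s * R) := by
      refine hw.of_norm_le (mul_nonneg (sq_nonneg _) hs'.1) fun k => ?_
      have h1 : |corr m p k| ≤ Λ := abs_corr_le hγ hw k
      have h2 := norm_cis_sub_one_le (s * -corr m p k)
      rw [abs_mul, abs_neg, abs_of_pos hs.1] at h2
      rw [norm_mul, norm_mul, norm_mul, Complex.norm_I, one_mul, Complex.norm_real,
        Real.norm_eq_abs]
      refine mul_le_mul_of_nonneg_right ?_ (norm_nonneg _)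
      calc |corr m p k| * ‖cis (s * -corr m p k) - 1‖ ≤ Λ * (s * Λ) :=
            mul_le_mul h1 (h2.trans (mul_le_mul_of_nonneg_left h1 hs.1.le)) (norm_nonneg _)
              ((abs_nonneg _).trans h1)
        _ = _ := by ring
    have b3 := (SobBd.cub hγ (symbolBd_errSymbol s) hw).neg
    refine ((b1.add b2).add b3).mono ?_
    rw [abs_of_pos hs.1]
    calc _ = localConst γ R * s := by
          rw [localConst, ← hΛ]
          ring
      _ ≤ _ := by
          refine mul_le_mul_of_nonneg_left hs'.2 ?_
          rw [localConst]
          positivity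
  have hK : 0 ≤ localConst γ R := by
    rw [localConst]
    positivity
  have hmv := SobBd.mean_value hτ (mul_nonneg hK hτ) hDc hDd hDB
  have hD0 : ∀ k, D 0 k = 0 := fun k => by
    have h0 : cub (stepSymbol 0) w k = 0 := by
      rw [cub, tri]
      refine (tsum_congr fun q => ?_).trans tsum_zero
      simp [stepSymbol, cis_zero]
    simp [hD, hv, h0, cis_zero, ← hwdef]
  refine (hmv.of_norm_le' fun k => le_of_eq ?_).mono (le_of_eq (by ring))
  have hfac : c (t₀ + τ) k - stepSeq τ m p w k = cis (τ * -(k : ℝ) ^ 2) * D τ k := by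
    have h1 : cis (τ * -(k : ℝ) ^ 2) * cis (τ * (k : ℝ) ^ 2) = 1 := by
      rw [← cis_add, ← cis_zero]
      congr 1
      ring
    simp only [hD, hv, stepSeq]
    linear_combination (-c (t₀ + τ) k) * h1
  rw [hfac, norm_mul, norm_cis, one_mul, hD0, sub_zero]

/-- Stability of one step of the integrator in `H^γ`. -/
lemma SobBd.stepSeq_sub (hγ : 3 / 2 < γ) {w w' : ℤ → ℂ} {A B s m p L : ℝ} (hs : 0 ≤ s)
    (hw : SobBd γ w A) (hw' : SobBd γ w' A) (h : SobBd γ (fun k => w k - w' k) B) (hm : |m| ≤ L) :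
    SobBd γ (fun k => stepSeq s m p w k - stepSeq s m p w' k)
      ((1 + (2 * L + 30 * triConst γ * A ^ 2) * s) * B) := by
  -- Real mass and momentum make the linear part unitary; only the zero mode and cubic terms
  -- increase the Lipschitz constant, both by `O(s)`.
  have b1 : SobBd γ (fun k => cis (s * -corr m p k) * (w k - w' k)) B :=
    h.of_norm_le' fun k => by rw [norm_mul, norm_cis, one_mul]
  have hL : 0 ≤ L := (abs_nonneg _).trans hm
  have b2 : SobBd γ (fun k => if k = 0 then 2 * Complex.I * s * m * (w k - w' k) else 0)
      (2 * s * L * B) := by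
    refine h.of_norm_le (by positivity) fun k => ?_
    split_ifs
    · rw [norm_mul, norm_mul, norm_mul, norm_mul, Complex.norm_I, Complex.norm_real,
        Complex.norm_real, Complex.norm_ofNat, Real.norm_eq_abs, Real.norm_eq_abs, abs_of_nonneg hs]
      rw [mul_one]
      gcongr
    · rw [norm_zero]
      positivity
  have b3 := SobBd.cub_sub hγ (symbolBd_stepSymbol s) hw hw' h
  refine (((b1.add b2).add b3).of_norm_le' fun k => le_of_eq ?_).mono (le_of_eq ?_)
  · have : stepSeq s m p w k - stepSeq s m p w' k = cis (s * -(k : ℝ) ^ 2) *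
        (cis (s * -corr m p k) * (w k - w' k) +
          (if k = 0 then 2 * Complex.I * s * m * (w k - w' k) else 0) +
          (CubicNLS.cub (stepSymbol s) w k - CubicNLS.cub (stepSymbol s) w' k)) := by
      rw [stepSeq, stepSeq]
      split_ifs with hk
      · rw [hk]
        ring
      · ring
    rw [this, norm_mul, norm_cis, one_mul]
  · rw [abs_of_nonneg hs]
    ring

lemma SobBd.stepSeq (hγ : 3 / 2 < γ) {A : ℝ} (s m p : ℝ) (hw : SobBd γ w A) :
    ∃ B, SobBd γ (CubicNLS.stepSeq s m p w) B := by
  have b1 : SobBd γ (fun k => cis (s * -corr m p k) * w k) A :=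
    hw.of_norm_le' fun k => by rw [norm_mul, norm_cis, one_mul]
  have b2 : SobBd γ (fun k => if k = 0 then 2 * Complex.I * s * m * w 0 else 0)
      (‖2 * Complex.I * s * m‖ * A) := by
    refine hw.of_norm_le (norm_nonneg _) fun k => ?_
    split_ifs with hk
    · rw [hk, norm_mul]
    · rw [norm_zero]
      positivity
  have b3 := SobBd.cub hγ (symbolBd_stepSymbol s) hw
  exact ⟨_, ((b1.add b2).add b3).of_norm_le' fun k => by
    rw [CubicNLS.stepSeq, norm_mul, norm_cis, one_mul]⟩

/-- The numerical solution in terms of Fourier coefficients. -/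
def numSeq (τ m p : ℝ) (w : ℤ → ℂ) : ℕ → ℤ → ℂ
  | 0 => w
  | n + 1 => stepSeq τ m p (numSeq τ m p w n)

/-- A qualitative bound, not uniform in `n`: it puts every iterate in `H^γ` without any restriction
on the step size. -/
lemma exists_sobBd_numSeq (hγ : 3 / 2 < γ) {A : ℝ} (τ m p : ℝ) (hw : SobBd γ w A) (n : ℕ) :
    ∃ B, SobBd γ (numSeq τ m p w n) B := by
  induction n with
  | zero => exact ⟨A, hw⟩
  | succ n ih =>
    obtain ⟨B, hB⟩ := ih
    exact hB.stepSeq hγ τ m p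

/-- First order convergence of the integrator, on the Fourier side. -/
lemma exists_global_error (hγ : 3 / 2 < γ) (T R : ℝ) : ∃ τ₀ C : ℝ, 0 < τ₀ ∧ 0 < C ∧
    ∀ c : ℝ → ℤ → ℂ, SeqSol γ T R c → ∀ τ : ℝ, 0 < τ → τ ≤ τ₀ → ∀ n : ℕ, n * τ ≤ T →
      SobBd γ (fun k => c (n * τ) k - numSeq τ (quadForm (fun _ => 1) (c 0))
        (quadForm (fun j => (j : ℝ)) (c 0)) (c 0) n k) (C * τ) := by
  set L := Real.sqrt (∑' k : ℤ, bracket k ^ (-(2 * γ - 2))) * R ^ 2 with hL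
  -- The sum of the stability constant on the ball of radius `R + 1` and the local error constant.
  -- The absolute value covers negative `R`.
  set K := 2 * L + 30 * triConst γ * (R + 1) ^ 2 + |localConst γ R| with hK
  have hL0 : 0 ≤ L := by positivity
  have hK0 : 0 ≤ K := by
    have := triConst_nonneg γ
    positivity
  -- The threshold is the reciprocal of `C`, so that the error `Cτ` never exceeds `1` and the
  -- numerical solution stays in the ball of radius `R + 1`.
  refine ⟨Real.exp (-(K * T)), Real.exp (K * T), Real.exp_pos _, Real.exp_pos _,
    fun c hc τ hτ hτ₀ n hn => ?_⟩
  have hT : 0 ≤ T := le_trans (by positivity) hn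
  have h00 : (0 : ℝ) ∈ Set.Icc 0 T := ⟨le_rfl, hT⟩
  set m := quadForm (fun _ => 1) (c 0) with hm
  set p := quadForm (fun j => (j : ℝ)) (c 0) with hp
  have hmL : |m| ≤ L := abs_quadForm_le hγ (hc.bound 0 h00) fun k => by
    simpa using one_le_bracket k
  have hgrow : ∀ n : ℕ, n * τ ≤ T → (1 + K * τ) ^ n ≤ Real.exp (K * T) := fun n hn => by
    calc (1 + K * τ) ^ n ≤ Real.exp (K * τ) ^ n := by
          refine pow_le_pow_left₀ (by positivity) ?_ n
          linarith [Real.add_one_le_exp (K * τ)]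
      _ = Real.exp (K * (n * τ)) := by
          rw [← Real.exp_nat_mul]
          congr 1
          ring
      _ ≤ _ := Real.exp_le_exp.2 (mul_le_mul_of_nonneg_left hn hK0)
  have hsmall : Real.exp (K * T) * τ ≤ 1 := by
    calc _ ≤ Real.exp (K * T) * Real.exp (-(K * T)) :=
          mul_le_mul_of_nonneg_left hτ₀ (Real.exp_pos _).le
      _ = 1 := by rw [← Real.exp_add, add_neg_cancel, Real.exp_zero]
  -- The quantity `((1+Kτ)^n - 1)τ` solves `d_{n+1} = (1+Kτ)d_n + Kτ²` with `d_0 = 0`.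
  suffices h : SobBd γ (fun k => c (n * τ) k - numSeq τ m p (c 0) n k)
      (((1 + K * τ) ^ n - 1) * τ) from
    h.mono (mul_le_mul_of_nonneg_right (by linarith [hgrow n hn]) hτ.le)
  induction n with
  | zero => simpa [numSeq] using SobBd.zero γ
  | succ n ih =>
    push_cast at hn
    have hn' : (n : ℝ) * τ ≤ T := by nlinarith
    have hmem : (n : ℝ) * τ ∈ Set.Icc 0 T := ⟨by positivity, hn'⟩
    have ih := ih hn'
    have hcB := hc.bound _ hmem
    set d := ((1 + K * τ) ^ n - 1) * τ with hd
    have hd0 : 0 ≤ d := ih.nonneg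
    have hd1 : d ≤ 1 := by
      refine le_trans (mul_le_mul_of_nonneg_right ?_ hτ.le) hsmall
      linarith [hgrow n hn']
    have hnB : SobBd γ (numSeq τ m p (c 0) n) (R + 1) :=
      ((hcB.sub ih).of_norm_le' fun k => by simp).mono (by linarith)
    have e1 := hc.local_error hγ hmem.1 hτ.le (by linarith : (n : ℝ) * τ + τ ≤ T)
    -- The local error is stated with the mass and momentum at time `nτ`; conservation replaces them
    -- by the initial values that the scheme uses.
    rw [hc.quadForm_eq hγ (fun k => by simpa using one_le_bracket k) (fun _ _ _ _ _ => rfl) hmem,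
      hc.quadForm_eq hγ (α := fun j => (j : ℝ)) abs_le_bracket
        (fun _ _ _ _ h => by exact_mod_cast h) hmem, ← hm, ← hp] at e1
    have e2 := SobBd.stepSeq_sub hγ (p := p) hτ.le (hcB.mono (by linarith)) hnB ih hmL
    refine ((e1.add e2).of_norm_le' fun k => le_of_eq ?_).mono ?_
    · congr 1
      rw [numSeq]
      push_cast
      rw [add_mul, one_mul]
      ring
    · have h1 : localConst γ R * τ ^ 2 ≤ K * τ ^ 2 := by
        refine mul_le_mul_of_nonneg_right ((le_abs_self _).trans ?_) (sq_nonneg _)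
        have := triConst_nonneg γ
        have : 0 ≤ 2 * L + 30 * triConst γ * (R + 1) ^ 2 := by positivity
        linarith
      have h2 : (1 + (2 * L + 30 * triConst γ * (R + 1) ^ 2) * τ) * d ≤ (1 + K * τ) * d := by
        gcongr
        linarith [abs_nonneg (localConst γ R)]
      calc _ ≤ K * τ ^ 2 + (1 + K * τ) * d := add_le_add h1 h2
        _ = _ := by
          rw [hd, pow_succ]
          ring

end Step

/-! ### Functions with absolutely convergent Fourier series -/

/-- `f` is almost everywhere the sum of the absolutely convergent Fourier series `∑ₖ aₖ e^{ikx}`. -/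
structure HasFS (f : Torus → ℂ) (a : ℤ → ℂ) : Prop where
  summable : Summable fun k => ‖a k‖
  ae : f =ᵐ[AddCircle.haarAddCircle (T := 2 * π)] fun x => ∑' k, a k * fourier k x

lemma norm_mul_fourier (z : ℂ) (k : ℤ) (x : Torus) : ‖z * fourier k x‖ = ‖z‖ := by
  rw [norm_mul, fourier_apply, Circle.norm_coe, mul_one]

lemma continuous_tsum_fourier {a : ℤ → ℂ} (ha : Summable fun k => ‖a k‖) :
    Continuous fun x : Torus => ∑' k, a k * fourier k x :=
  continuous_tsum (fun k => continuous_const.mul (fourier k).continuous) ha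
    fun _ _ => (norm_mul_fourier _ _ _).le

lemma summable_mul_fourier {a : ℤ → ℂ} (ha : Summable fun k => ‖a k‖) (x : Torus) :
    Summable fun k => a k * fourier k x :=
  Summable.of_norm (ha.congr fun _ => (norm_mul_fourier _ _ _).symm)

/-- Absolute summability permits termwise integration, and orthogonality of the characters leaves
one term. -/
lemma fourierCoeff_tsum {a : ℤ → ℂ} (ha : Summable fun k => ‖a k‖) (n : ℤ) :
    fourierCoeff (fun x : Torus => ∑' k, a k * fourier k x) n = a n := by
  have hcont : ∀ k, Continuous fun t : Torus => fourier (-n) t • (a k * fourier k t) := fun k =>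
    (fourier (-n)).continuous.smul (continuous_const.mul (fourier k).continuous)
  have hnorm : ∀ (k : ℤ) (t : Torus), ‖fourier (-n) t • (a k * fourier k t)‖ = ‖a k‖ :=
    fun k t => by rw [norm_smul, norm_mul_fourier, fourier_apply, Circle.norm_coe, one_mul]
  have h := MeasureTheory.integral_tsum_of_summable_integral_norm
    (μ := AddCircle.haarAddCircle (T := 2 * π))
    (F := fun (k : ℤ) (t : Torus) => fourier (-n) t • (a k * fourier k t))
    (fun k => (hcont k).integrable_of_hasCompactSupport (HasCompactSupport.of_compactSpace _))
    (by simpa only [hnorm, integral_const, probReal_univ, one_smul] using ha)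
  have h1 : ∀ k, ∫ t : Torus, fourier (-n) t • (a k * fourier k t) ∂AddCircle.haarAddCircle =
      if k = n then a n else 0 := fun k => by
    have h2 := fourierCoeff.const_mul (fun t : Torus => fourier k t) (a k) n
    rw [fourierCoeff] at h2
    rw [h2, show fourierCoeff (fun t : Torus => fourier k t) = Pi.single k 1 from
      fourierCoeff_fourier k]
    by_cases hk : k = n
    · subst hk
      simp
    · simp [hk]
  rw [fourierCoeff]
  simp only [h1, tsum_ite_eq] at h
  rw [h]
  refine integral_congr_ae (.of_forall fun t => ?_)
  simp only [smul_eq_mul]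
  rw [tsum_mul_left]

namespace HasFS

variable {f g : Torus → ℂ} {a b c : ℤ → ℂ}

lemma fourierCoeff_eq (hf : HasFS f a) : fourierCoeff f = a := by
  funext n
  rw [fourierCoeff_congr_ae hf.ae, fourierCoeff_tsum hf.summable]

lemma memLp (hf : HasFS f a) : MemLp f 2 (AddCircle.haarAddCircle (T := 2 * π)) := by
  refine MemLp.ae_eq hf.ae.symm ?_
  exact (continuous_tsum_fourier hf.summable).memLp_of_hasCompactSupport
    (HasCompactSupport.of_compactSpace _)

lemma congr (hf : HasFS f a) (h : ∀ k, b k = a k) : HasFS f b := by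
  rwa [funext h]

/-- The function and its continuous Fourier sum have the same coefficients, so they coincide in `L²`
by completeness of the Fourier basis. -/
lemma of_memLp (hf : MemLp f 2 (AddCircle.haarAddCircle (T := 2 * π)))
    (hs : Summable fun k => ‖fourierCoeff f k‖) : HasFS f (fourierCoeff f) := by
  refine ⟨hs, ?_⟩
  have hg : MemLp (fun x : Torus => ∑' k, fourierCoeff f k * fourier k x) 2
      (AddCircle.haarAddCircle (T := 2 * π)) :=
    (continuous_tsum_fourier hs).memLp_of_hasCompactSupport (HasCompactSupport.of_compactSpace _)
  refine (MemLp.toLp_eq_toLp_iff hf hg).1 ?_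
  refine fourierBasis.repr.injective (lp.ext (funext fun n => ?_))
  rw [fourierBasis_repr, fourierBasis_repr, fourierCoeff_congr_ae hf.coeFn_toLp,
    fourierCoeff_congr_ae hg.coeFn_toLp, fourierCoeff_tsum hs]

lemma add (hf : HasFS f a) (hg : HasFS g b) :
    HasFS (fun x => f x + g x) (fun k => a k + b k) := by
  refine ⟨(hf.summable.add hg.summable).of_nonneg_of_le (fun _ => norm_nonneg _)
    fun k => norm_add_le _ _, ?_⟩
  filter_upwards [hf.ae, hg.ae] with x hx hy
  rw [hx, hy, ← (summable_mul_fourier hf.summable x).tsum_add (summable_mul_fourier hg.summable x)]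
  exact tsum_congr fun k => by ring

lemma const_mul (hf : HasFS f a) (z : ℂ) : HasFS (fun x => z * f x) (fun k => z * a k) := by
  refine ⟨(hf.summable.mul_left ‖z‖).congr fun k => (norm_mul _ _).symm, ?_⟩
  filter_upwards [hf.ae] with x hx
  rw [hx, ← tsum_mul_left]
  exact tsum_congr fun k => by ring

lemma sub (hf : HasFS f a) (hg : HasFS g b) :
    HasFS (fun x => f x - g x) (fun k => a k - b k) := by
  simpa [sub_eq_add_neg] using hf.add (hg.const_mul (-1))

lemma const (z : ℂ) : HasFS (fun _ => z) (fun k => if k = 0 then z else 0) := by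
  refine ⟨summable_of_ne_finset_zero (s := {0}) fun k hk => ?_, .of_forall fun x => ?_⟩
  · rw [if_neg (by simpa using hk), norm_zero]
  · simp

lemma conj_fun (hf : HasFS f a) : HasFS (conjFun f) (conjSeq a) := by
  refine ⟨((Equiv.neg ℤ).summable_iff.2 hf.summable).congr fun k => by simp [conjSeq], ?_⟩
  filter_upwards [hf.ae] with x hx
  rw [conjFun, hx, Complex.conj_tsum, ← (Equiv.neg ℤ).tsum_eq]
  refine tsum_congr fun k => ?_
  simp [conjSeq]

/-- The Fourier coefficients of a product. -/
lemma mul (hf : HasFS f a) (hg : HasFS g b) :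
    HasFS (f * g) (fun k => ∑' j, a j * b (k - j)) := by
  have hab := hf.summable.mul_of_nonneg hg.summable (fun _ => norm_nonneg _) fun _ => norm_nonneg _
  let e : ℤ × ℤ ≃ ℤ × ℤ :=
    { toFun := fun p => (p.2, p.1 - p.2)
      invFun := fun p => (p.1 + p.2, p.1)
      left_inv := fun p => by simp
      right_inv := fun p => by simp }
  have hn : Summable fun p : ℤ × ℤ => ‖a p.2 * b (p.1 - p.2)‖ :=
    (e.summable_iff.2 hab).congr fun p => (norm_mul _ _).symm
  refine ⟨hn.prod.of_nonneg_of_le (fun _ => norm_nonneg _) fun k =>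
    norm_tsum_le_tsum_norm (hn.prod_factor k), ?_⟩
  filter_upwards [hf.ae, hg.ae] with x hx hy
  have h1 : ∀ {c : ℤ → ℂ}, (Summable fun k => ‖c k‖) →
      Summable fun k => ‖c k * fourier k x‖ := fun hc =>
    hc.congr fun k => (norm_mul_fourier _ _ _).symm
  rw [Pi.mul_apply, hx, hy, tsum_mul_tsum_of_summable_norm (h1 hf.summable) (h1 hg.summable),
    ← e.tsum_eq]
  have h2 : ∀ p : ℤ × ℤ, a (e p).1 * fourier (e p).1 x * (b (e p).2 * fourier (e p).2 x) =
      a p.2 * b (p.1 - p.2) * fourier p.1 x := fun p => by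
    have h3 : (fourier p.1 x : ℂ) = fourier p.2 x * fourier (p.1 - p.2) x := by
      rw [← fourier_add, add_sub_cancel]
    rw [h3]
    simp only [e, Equiv.coe_fn_mk]
    ring
  simp only [h2]
  have h3 : Summable fun p : ℤ × ℤ => a p.2 * b (p.1 - p.2) * fourier p.1 x :=
    Summable.of_norm (hn.congr fun p => (norm_mul_fourier _ _ _).symm)
  rw [h3.tsum_prod]
  refine tsum_congr fun k => ?_
  dsimp only
  rw [tsum_mul_right]

lemma multiplier (hf : HasFS f a) {m : ℤ → ℂ} (hm : Summable fun k => ‖m k * a k‖) :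
    HasFS (fourierMultiplier m f) (fun k => m k * a k) :=
  ⟨hm, .of_forall fun x => by rw [fourierMultiplier, hf.fourierCoeff_eq]⟩

lemma multiplier_of_norm_le_one (hf : HasFS f a) {m : ℤ → ℂ} (hm : ∀ k, ‖m k‖ ≤ 1) :
    HasFS (fourierMultiplier m f) (fun k => m k * a k) :=
  hf.multiplier (hf.summable.of_nonneg_of_le (fun _ => norm_nonneg _) fun k => by
    rw [norm_mul]
    exact mul_le_of_le_one_left (norm_nonneg _) (hm k))

lemma zeroMode_eq (hf : HasFS f a) : zeroMode f = a 0 := by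
  rw [← hf.fourierCoeff_eq, fourierCoeff, zeroMode]
  simp

lemma absSq (hf : HasFS f a) : HasFS (absSq f) (fun k => ∑' j, conjSeq a j * a (k - j)) := by
  have : CubicNLS.absSq f = conjFun f * f := by
    funext x
    rw [Pi.mul_apply, conjFun, mul_comm, Complex.mul_conj, Complex.normSq_eq_norm_sq,
      CubicNLS.absSq]
  rw [this]
  exact hf.conj_fun.mul hf

/-- The Fourier coefficients of `f · m(∂ₓ)(g h)`. -/
lemma mul_of_conv {G : Torus → ℂ} {m : ℤ → ℂ} (hm : ∀ k, ‖m k‖ ≤ 1) (hf : HasFS f a)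
    (hb : Summable fun k => ‖b k‖) (hc : Summable fun k => ‖c k‖)
    (hG : HasFS G (fun k => m k * ∑' j, b j * c (k - j))) :
    HasFS (f * G) (tri (fun _ x y => m (x + y)) a b c) := by
  refine (hf.mul hG).congr fun k => ?_
  have hab := hf.summable.mul_of_nonneg hb (fun _ => norm_nonneg _) fun _ => norm_nonneg _
  have hsum : Summable fun p : ℤ × ℤ =>
      m (p.2 + (k - p.1 - p.2)) * (a p.1 * b p.2 * c (k - p.1 - p.2)) := by
    refine Summable.of_norm_bounded (hab.mul_right (∑' j, ‖c j‖)) fun p => ?_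
    rw [norm_mul, norm_mul, norm_mul]
    calc _ ≤ 1 * (‖a p.1‖ * ‖b p.2‖ * ∑' j, ‖c j‖) := by
          gcongr
          · exact hm _
          · exact hc.le_tsum (k - p.1 - p.2) fun _ _ => norm_nonneg _
      _ = _ := one_mul _
  rw [tri, hsum.tsum_prod]
  refine tsum_congr fun i => ?_
  rw [← tsum_mul_left, ← tsum_mul_left]
  refine tsum_congr fun j => ?_
  rw [show j + (k - i - j) = k - i by ring]
  ring

end HasFS

/-- Used to bring the conjugated factor, which arises in the middle of `w · m(∂ₓ)(w̄ w)`, to the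
first slot. -/
lemma tri_rotate (m : ℤ → ℤ → ℤ → ℂ) (f g h : ℤ → ℂ) :
    tri m f g h = tri (fun a b c => m c a b) g h f := by
  funext k
  have h1 := tsum_swap_fst_thd (fun a b c => m a b c * (f a * g b * h c)) k
  have h2 := (Equiv.prodComm ℤ ℤ).tsum_eq fun p : ℤ × ℤ =>
    m (k - p.1 - p.2) p.2 p.1 * (f (k - p.1 - p.2) * g p.2 * h p.1)
  rw [tri, ← h1, ← h2, tri]
  refine tsum_congr fun p => ?_
  simp only [Equiv.prodComm_apply, Prod.fst_swap, Prod.snd_swap,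
    show k - p.2 - p.1 = k - p.1 - p.2 by ring]
  ring

lemma norm_symDInv_le (k : ℤ) : ‖symDInv k‖ ≤ 1 := by
  rw [symDInv]
  split_ifs with hk
  · simp
  · rw [norm_inv, norm_mul, Complex.norm_I, one_mul, norm_intCast]
    exact inv_le_one_of_one_le₀ (by exact_mod_cast Int.one_le_abs hk)

lemma exp_symD_sq (τ : ℝ) (k : ℤ) :
    Complex.exp (Complex.I * τ * symD k ^ 2) = cis (τ * -(k : ℝ) ^ 2) := by
  rw [cis, symD, mul_pow, Complex.I_sq]
  push_cast
  ring_nf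

/-! ### The integrator in Fourier coefficients -/

section Scheme

variable {w : Torus → ℂ} {a : ℤ → ℂ} {γ A : ℝ}

lemma HasFS.freeFlow (hw : HasFS w a) (τ : ℝ) :
    HasFS (freeFlow τ w) (fun k => cis (τ * -(k : ℝ) ^ 2) * a k) := by
  have := hw.multiplier_of_norm_le_one
    (m := fun k => Complex.exp (Complex.I * τ * symD k ^ 2)) fun k => by
      rw [exp_symD_sq, norm_cis]
  exact this.congr fun k => by rw [exp_symD_sq]

lemma HasFS.dxInv (hw : HasFS w a) : HasFS (dxInv w) (fun k => symDInv k * a k) :=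
  hw.multiplier_of_norm_le_one norm_symDInv_le

lemma HasFS.dxInvSq (hw : HasFS w a) : HasFS (dxInvSq w) (fun k => symDInv k ^ 2 * a k) :=
  hw.multiplier_of_norm_le_one fun k => by
    rw [norm_pow]
    exact pow_le_one₀ (norm_nonneg _) (norm_symDInv_le k)

lemma HasFS.cubic (hw : HasFS w a) : HasFS (cubic w) (cub (fun _ _ _ => 1) a) := by
  have h1 : HasFS (CubicNLS.absSq w) (fun k => 1 * ∑' j, conjSeq a j * a (k - j)) := by
    simpa using hw.absSq
  have h2 := HasFS.mul_of_conv (m := fun _ => 1) (by simp) hw hw.conj_fun.summable hw.summable h1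
  rw [tri_rotate] at h2
  rw [CubicNLS.cubic, mul_comm]
  exact h2

lemma HasFS.mul_dxInv_absSq (hw : HasFS w a) :
    HasFS (w * CubicNLS.dxInv (CubicNLS.absSq w)) (cub (fun x y _ => symDInv (x + y)) a) := by
  have h2 := HasFS.mul_of_conv norm_symDInv_le hw hw.conj_fun.summable hw.summable hw.absSq.dxInv
  rwa [tri_rotate] at h2

lemma HasFS.conj_mul_freeFlow_sq (hw : HasFS w a) (τ : ℝ) :
    HasFS (CubicNLS.freeFlow (-τ) (conjFun w) * CubicNLS.freeFlow τ (w ^ 2))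
      (cub (fun x y z => cis (τ * (x : ℝ) ^ 2) * cis (τ * -((y + z : ℤ) : ℝ) ^ 2)) a) := by
  have h1 := (hw.mul hw).freeFlow τ
  rw [← sq] at h1
  have h2 := HasFS.mul_of_conv (fun k => (norm_cis _).le) (hw.conj_fun.freeFlow (-τ)) hw.summable
    hw.summable h1
  refine h2.congr fun k => tsum_congr fun p => ?_
  simp only [neg_mul_neg]
  ring

lemma cub_cis_mul (τ : ℝ) (m : ℤ → ℤ → ℤ → ℂ) (a : ℤ → ℂ) (k : ℤ) :
    cub m (fun j => cis (τ * -(j : ℝ) ^ 2) * a j) k =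
      cis (τ * -(k : ℝ) ^ 2) * cub (fun x y z => cis (τ * phase x y z) * m x y z) a k := by
  rw [cub, tri, cub, tri, ← tsum_mul_left]
  refine tsum_congr fun q => ?_
  obtain ⟨x, y⟩ := q
  simp only [conjSeq, map_mul, conj_cis]
  have : cis (-(τ * -((-x : ℤ) : ℝ) ^ 2)) * cis (τ * -(y : ℝ) ^ 2) *
      cis (τ * -((k - x - y : ℤ) : ℝ) ^ 2) =
        cis (τ * -(k : ℝ) ^ 2) * cis (τ * phase x y (k - x - y)) := by
    rw [← cis_add, ← cis_add, ← cis_add]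
    congr 1
    rw [phase]
    push_cast
    ring
  linear_combination (m x y (k - x - y) * (starRingEnd ℂ) (a (-x)) * a y * a (k - x - y)) * this

lemma exp_modified (τ m p : ℝ) (k : ℤ) :
    Complex.exp (Complex.I * τ * (-2 * (m : ℂ) - 2 * (-Complex.I * p) * symDInv k + symD k ^ 2)) =
      cis (τ * -(k : ℝ) ^ 2) * cis (τ * -corr m p k) := by
  rw [← cis_add, cis, symDInv, symD, corr]
  congr 1
  split_ifs with hk
  · simp [hk]
    ring
  · have hk' : (k : ℂ) ≠ 0 := by exact_mod_cast hk
    push_cast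
    field_simp
    ring_nf
    simp only [Complex.I_sq]
    ring

/-- The Fourier coefficients of one step of the integrator. -/
lemma HasFS.psi (hγ : 3 / 2 < γ) (hw : HasFS w a) (ha : SobBd γ a A) (τ m p : ℝ) :
    HasFS (Psi τ m (-Complex.I * p) w) (stepSeq τ m p a) := by
  have t1 : HasFS (modifiedFlow τ m (-Complex.I * p) w)
      (fun k => cis (τ * -(k : ℝ) ^ 2) * cis (τ * -corr m p k) * a k) := by
    have := hw.multiplier_of_norm_le_one (m := fun k => Complex.exp (Complex.I * τ *
      (-2 * (m : ℂ) - 2 * (-Complex.I * p) * symDInv k + symD k ^ 2))) fun k => by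
        rw [exp_modified, norm_mul, norm_cis, norm_cis, one_mul]
    exact this.congr fun k => by rw [exp_modified]
  have t2 := HasFS.const (Complex.I * τ * zeroMode (CubicNLS.cubic w))
  have t3 := HasFS.const (2 * Complex.I * τ * m * zeroMode w)
  have t4 := (hw.conj_mul_freeFlow_sq τ).dxInvSq.const_mul (1 / 2)
  have t5 := (hw.cubic.dxInvSq.freeFlow τ).const_mul (1 / 2)
  have t6 := (hw.freeFlow τ).mul_dxInv_absSq.dxInv
  have t7 := (hw.mul_dxInv_absSq.dxInv).freeFlow τ
  refine (((((((t1.sub t2).add t3).sub t4).add t5).add t6).sub t7)).congr fun k => ?_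
  rw [hw.zeroMode_eq, hw.cubic.zeroMode_eq, stepSeq, cub_cis_mul]
  by_cases hk : k = 0
  · subst hk
    have h1 : symDInv 0 = 0 := by simp [symDInv]
    -- On the zero mode the inverse derivatives vanish, and the explicit mean of the cubic term
    -- supplies the whole step symbol.
    have h2 : cub (stepSymbol τ) a 0 = -(Complex.I * τ) * cub (fun _ _ _ => 1) a 0 := by
      rw [← cub_const_mul]
      refine cub_congr a 0 fun x y z h => ?_
      rw [stepSymbol, if_pos h, mul_one]
    have h3 : cis (τ * -((0 : ℤ) : ℝ) ^ 2) = 1 := by simp [cis]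
    rw [h1, h2, h3]
    simp only [if_true]
    ring
  · simp only [if_neg hk]
    have hk' : (k : ℂ) ≠ 0 := by exact_mod_cast hk
    have hs : ∀ {n : ℤ → ℤ → ℤ → ℂ}, (∀ x y z, ‖n x y z‖ ≤ 1) → HasSum (fun q : ℤ × ℤ =>
        n q.1 q.2 (k - q.1 - q.2) * (conjSeq a q.1 * a q.2 * a (k - q.1 - q.2))) (cub n a k) :=
      fun hn => (cub_summable hγ (.of_norm_le_one hn) ha k).hasSum
    have s1 := hs (n := fun x y z => cis (τ * (x : ℝ) ^ 2) * cis (τ * -((y + z : ℤ) : ℝ) ^ 2))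
      fun x y z => by rw [norm_mul, norm_cis, norm_cis, one_mul]
    have s2 := hs (n := fun _ _ _ => 1) (by simp)
    have s3 := hs (n := fun x y z => cis (τ * phase x y z) * symDInv (x + y))
      fun x y z => by
        rw [norm_mul, norm_cis, one_mul]
        exact norm_symDInv_le _
    have s4 := hs (n := fun x y _ => symDInv (x + y)) fun x y _ => norm_symDInv_le _
    have s5 : HasSum _ (cis (τ * -(k : ℝ) ^ 2) * cub (stepSymbol τ) a k) :=
      (cub_summable hγ (symbolBd_stepSymbol τ) ha k).hasSum.mul_left _
    have s6 := ((((s1.mul_left (-(1 / 2) * symDInv k ^ 2)).add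
      (s2.mul_left (1 / 2 * (cis (τ * -(k : ℝ) ^ 2) * symDInv k ^ 2)))).add
      (s3.mul_left (symDInv k * cis (τ * -(k : ℝ) ^ 2)))).add
      (s4.mul_left (-(cis (τ * -(k : ℝ) ^ 2) * symDInv k))))
    -- Both sides are sums over the same index set, so it suffices to compare symbols termwise.
    have key := s5.unique (s6.congr_fun fun q => ?_)
    · linear_combination key
    · have hsum : q.1 + q.2 + (k - q.1 - q.2) = k := by ring
      -- Multiplying `w²` out before applying the free flow yields the phase at `b + c = k - a`,
      -- hence the low phase `2ka`.
      have h1 : cis (τ * (q.1 : ℝ) ^ 2) * cis (τ * -((q.2 + (k - q.1 - q.2) : ℤ) : ℝ) ^ 2) =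
          cis (τ * -(k : ℝ) ^ 2) * cis (τ * lowPhase q.1 q.2 (k - q.1 - q.2)) := by
        rw [← cis_add, ← cis_add]
        congr 1
        rw [lowPhase]
        push_cast
        ring
      rw [h1, stepSymbol, hsum, if_neg hk, symDInv, if_neg hk, symDInv]
      have hI : (Complex.I * (k : ℂ))⁻¹ ^ 2 = -(1 / (k : ℂ) ^ 2) := by
        rw [inv_pow, mul_pow, Complex.I_sq]
        field_simp
      by_cases hab : q.1 + q.2 = 0
      · rw [if_pos hab, if_pos hab, hI]
        field_simp
        ring
      · have hab' : ((q.1 + q.2 : ℤ) : ℂ) ≠ 0 := by exact_mod_cast hab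
        have hII : (Complex.I * (k : ℂ))⁻¹ * (Complex.I * ((q.1 + q.2 : ℤ) : ℂ))⁻¹ =
            -(1 / ((k : ℂ) * ((q.1 + q.2 : ℤ) : ℂ))) := by
          rw [← mul_inv, mul_mul_mul_comm, Complex.I_mul_I]
          field_simp
        rw [if_neg hab, if_neg hab, hI]
        generalize cis (τ * -(k : ℝ) ^ 2) = E
        generalize cis (τ * lowPhase q.1 q.2 (k - q.1 - q.2)) = E1
        generalize cis (τ * phase q.1 q.2 (k - q.1 - q.2)) = E2
        generalize conjSeq a q.1 * a q.2 * a (k - q.1 - q.2) = X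
        linear_combination (E * (1 - E2) * X) * hII

lemma mass_eq (hw : HasFS w a) :
    mass w = (quadForm (fun _ => 1) a : ℝ) := by
  rw [mass, hw.absSq.zeroMode_eq, quadForm, Complex.ofReal_tsum, ← (Equiv.neg ℤ).tsum_eq]
  refine tsum_congr fun j => ?_
  simp only [Equiv.neg_apply, conjSeq, neg_neg, zero_sub]
  rw [mul_comm, Complex.mul_conj, Complex.normSq_eq_norm_sq, one_mul]

lemma momentum_eq (hγ : 3 / 2 < γ) (hw : HasFS w a) (ha : SobBd γ a A) :
    momentum w = -Complex.I * (quadForm (fun j => (j : ℝ)) a : ℝ) := by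
  have hd : HasFS (dx (conjFun w)) (fun k => symD k * conjSeq a k) := by
    refine hw.conj_fun.multiplier ((ha.conjSeq.summable_bracket_mul hγ).1.of_nonneg_of_le
      (fun _ => norm_nonneg _) fun k => ?_)
    rw [norm_mul, symD, norm_mul, Complex.norm_I, one_mul, norm_intCast]
    exact mul_le_mul_of_nonneg_right (abs_le_bracket k) (norm_nonneg _)
  rw [momentum, (hw.mul hd).zeroMode_eq, quadForm, Complex.ofReal_tsum, ← tsum_mul_left]
  refine tsum_congr fun j => ?_
  simp only [conjSeq, zero_sub, neg_neg, symD]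
  push_cast
  rw [show a j * (Complex.I * -(j : ℂ) * (starRingEnd ℂ) (a j)) =
    -Complex.I * (j * (a j * (starRingEnd ℂ) (a j))) by ring, Complex.mul_conj,
    Complex.normSq_eq_norm_sq]
  push_cast
  ring

end Scheme

/-! ### The convergence theorem -/

section Main

variable {γ : ℝ}

lemma MemH.sobBd {f : Torus → ℂ} (hf : MemH γ f) : SobBd γ (fourierCoeff f) (hNorm γ f) := by
  refine ⟨Real.sqrt_nonneg _, fun S => ?_⟩
  have h0 : ∀ k : ℤ, 0 ≤ (1 + (k : ℝ) ^ 2) ^ γ * ‖fourierCoeff f k‖ ^ 2 := fun k => by positivity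
  have h1 : 0 ≤ ∑' k : ℤ, (1 + (k : ℝ) ^ 2) ^ γ * ‖fourierCoeff f k‖ ^ 2 := tsum_nonneg h0
  rw [hNorm, Real.sq_sqrt (by positivity)]
  calc _ = ∑ k ∈ S, (1 + (k : ℝ) ^ 2) ^ γ * ‖fourierCoeff f k‖ ^ 2 :=
        Finset.sum_congr rfl fun k _ => by rw [mul_pow, bracket_rpow_sq]
    _ ≤ ∑' k : ℤ, (1 + (k : ℝ) ^ 2) ^ γ * ‖fourierCoeff f k‖ ^ 2 :=
        hf.summable.sum_le_tsum S fun k _ => h0 k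
    _ ≤ _ := le_mul_of_one_le_left h1 (by linarith [Real.pi_gt_three])

lemma SobBd.summable_sq {a : ℤ → ℂ} {B : ℝ} (h : SobBd γ a B) :
    (Summable fun k : ℤ => (1 + (k : ℝ) ^ 2) ^ γ * ‖a k‖ ^ 2) ∧
      ∑' k : ℤ, (1 + (k : ℝ) ^ 2) ^ γ * ‖a k‖ ^ 2 ≤ B ^ 2 := by
  have key : ∀ S : Finset ℤ, ∑ k ∈ S, (1 + (k : ℝ) ^ 2) ^ γ * ‖a k‖ ^ 2 ≤ B ^ 2 := fun S => by
    refine le_of_eq_of_le (Finset.sum_congr rfl fun k _ => ?_) (h.sum_le S)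
    rw [mul_pow, bracket_rpow_sq]
  have hs := summable_of_sum_le (fun k => by positivity) key
  exact ⟨hs, hs.tsum_le_of_sum_le key⟩

lemma SobBd.hNorm_le {f : Torus → ℂ} {B : ℝ} (h : SobBd γ (fourierCoeff f) B) :
    hNorm γ f ≤ Real.sqrt (2 * π) * B := by
  rw [hNorm, Real.sqrt_mul Real.two_pi_pos.le]
  exact mul_le_mul_of_nonneg_left (Real.sqrt_le_iff.2 ⟨h.nonneg, h.summable_sq.2⟩)
    (Real.sqrt_nonneg _)

lemma HasFS.memH {f : Torus → ℂ} {a : ℤ → ℂ} {B : ℝ} (hf : HasFS f a) (ha : SobBd γ a B) :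
    MemH γ f :=
  ⟨hf.memLp, by
    rw [hf.fourierCoeff_eq]
    exact ha.summable_sq.1⟩

lemma MemH.hasFS (hγ : 3 / 2 < γ) {f : Torus → ℂ} (hf : MemH γ f) : HasFS f (fourierCoeff f) :=
  HasFS.of_memLp hf.memLp (hf.sobBd.summable_norm hγ)

lemma MemH.sub (hγ : 3 / 2 < γ) {f g : Torus → ℂ} (hf : MemH γ f) (hg : MemH γ g) :
    MemH γ (f - g) :=
  ((hf.hasFS hγ).sub (hg.hasFS hγ)).memH (hf.sobBd.sub hg.sobBd)

lemma fourierCoeff_sub_apply (hγ : 3 / 2 < γ) {f g : Torus → ℂ} (hf : MemH γ f) (hg : MemH γ g)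
    (k : ℤ) : fourierCoeff (f - g) k = fourierCoeff f k - fourierCoeff g k :=
  congrFun ((hf.hasFS hγ).sub (hg.hasFS hγ)).fourierCoeff_eq k

lemma IsSolution.continuousOn_fourierCoeff (hγ : 3 / 2 < γ) {T : ℝ} {u₀ : Torus → ℂ}
    {u : ℝ → Torus → ℂ} (hu : IsSolution γ T u₀ u) (k : ℤ) :
    ContinuousOn (fun t => fourierCoeff (u t) k) (Set.Icc 0 T) := by
  intro t ht
  rw [ContinuousWithinAt, tendsto_iff_norm_sub_tendsto_zero]
  refine squeeze_zero' (.of_forall fun _ => norm_nonneg _) ?_ (hu.continuous t ht)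
  filter_upwards [self_mem_nhdsWithin] with s hs
  rw [← fourierCoeff_sub_apply hγ (hu.memH s hs) (hu.memH t ht)]
  exact ((hu.memH s hs).sub hγ (hu.memH t ht)).sobBd.norm_le (by linarith) k

/-- The essential supremum bounds almost every time only; such times are dense in `(0,T)`, so
continuity of the coefficients and `SobBd.of_tendsto` extend the bound to `[0,T]`. For negative `R`
the hypothesis bounds the norm by `0`, whence `max R 0`. -/
lemma IsSolution.seqSol (hγ : 3 / 2 < γ) {T R : ℝ} (hT : 0 < T) {u₀ : Torus → ℂ}
    {u : ℝ → Torus → ℂ} (hu : IsSolution γ T u₀ u) (hR : linftyHNorm T γ u ≤ ENNReal.ofReal R) :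
    SeqSol γ T (max R 0) (fun t => fourierCoeff (u t)) := by
  have hcont := hu.continuousOn_fourierCoeff hγ
  refine ⟨fun t ht => ?_, hcont, fun t ht k => ?_⟩
  · have hae : ∀ᵐ s : ℝ, s ∈ Set.Ioo 0 T → SobBd γ (fourierCoeff (u s)) (max R 0) := by
      rw [linftyHNorm, eLpNorm_exponent_top] at hR
      refine (ae_restrict_iff' measurableSet_Ioo).1 ?_
      filter_upwards [ae_le_eLpNormEssSup (f := fun t => hNorm γ (u t))
        (μ := volume.restrict (Set.Ioo 0 T)), ae_restrict_mem measurableSet_Ioo] with s hs hmem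
      refine (hu.memH s ⟨hmem.1.le, hmem.2.le⟩).sobBd.mono ?_
      have h1 := hs.trans hR
      rw [← ofReal_norm, Real.norm_of_nonneg (show 0 ≤ hNorm γ (u s) from Real.sqrt_nonneg _)] at h1
      rcases le_or_gt (hNorm γ (u s)) 0 with h2 | h2
      · exact h2.trans (le_max_right _ _)
      · exact ((ENNReal.ofReal_le_ofReal_iff'.1 h1).resolve_right (not_le.2 h2)).trans
          (le_max_left _ _)
    have hdense := Measure.dense_of_ae hae
    set G := {s : ℝ | s ∈ Set.Ioo 0 T → SobBd γ (fourierCoeff (u s)) (max R 0)} with hG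
    have hcl : t ∈ closure (Set.Ioo 0 T ∩ G) := by
      refine closure_minimal (hdense.open_subset_closure_inter isOpen_Ioo) isClosed_closure ?_
      rwa [closure_Ioo hT.ne]
    have : (𝓝[Set.Ioo 0 T ∩ G] t).NeBot := mem_closure_iff_nhdsWithin_neBot.1 hcl
    refine SobBd.of_tendsto (l := 𝓝[Set.Ioo 0 T ∩ G] t) (a := fun s => fourierCoeff (u s)) ?_
      fun k => ((hcont k) t ht).mono_left (nhdsWithin_mono _ fun s hs => ⟨hs.1.1.le, hs.1.2.le⟩)
    filter_upwards [self_mem_nhdsWithin] with s hs using hs.2 hs.1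
  · obtain ⟨d, hd, heq⟩ := hu.equation t ht k
    refine hd.congr_deriv ?_
    rw [((hu.memH t ⟨ht.1.le, ht.2.le⟩).hasFS hγ).cubic.fourierCoeff_eq, symD, mul_pow,
      Complex.I_sq] at heq
    linear_combination (-Complex.I) * heq + d * Complex.I_sq

lemma hasFS_numSol (hγ : 3 / 2 < γ) {u₀ : Torus → ℂ} (hu₀ : MemH γ u₀) (τ : ℝ) (n : ℕ) :
    HasFS (numSol τ u₀ n) (numSeq τ (quadForm (fun _ => 1) (fourierCoeff u₀))
      (quadForm (fun j => (j : ℝ)) (fourierCoeff u₀)) (fourierCoeff u₀) n) := by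
  induction n with
  | zero => exact hu₀.hasFS hγ
  | succ n ih =>
    obtain ⟨B, hB⟩ := exists_sobBd_numSeq hγ τ (quadForm (fun _ => 1) (fourierCoeff u₀))
      (quadForm (fun j => (j : ℝ)) (fourierCoeff u₀)) hu₀.sobBd n
    rw [numSol, numSeq, mass_eq (hu₀.hasFS hγ), momentum_eq hγ (hu₀.hasFS hγ) hu₀.sobBd]
    exact ih.psi hγ hB τ _ _

end Main

end CubicNLS

end

theorem theorem1p1 (γ : ℝ) (hγ : 3 / 2 < γ) (T : ℝ) (hT : 0 < T) (R : ℝ) :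
    ∃ τ₀ C : ℝ, 0 < τ₀ ∧ 0 < C ∧
      ∀ (u₀ : CubicNLS.Torus → ℂ) (u : ℝ → CubicNLS.Torus → ℂ),
        CubicNLS.MemH γ u₀ →
        CubicNLS.IsSolution γ T u₀ u →
        CubicNLS.linftyHNorm T γ u ≤ ENNReal.ofReal R →
        ∀ τ : ℝ, 0 < τ → τ ≤ τ₀ → ∀ n : ℕ, (n : ℝ) * τ ≤ T →
          CubicNLS.MemH γ (CubicNLS.numSol τ u₀ n) ∧
          CubicNLS.hNorm γ (u ((n : ℝ) * τ) - CubicNLS.numSol τ u₀ n) ≤ C * τ := by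
  obtain ⟨τ₀, C, hτ₀, hC, h⟩ := CubicNLS.exists_global_error hγ T (max R 0)
  -- The factor `√(2π)` restores the normalization of the Sobolev norm, which `SobBd` omits.
  refine ⟨τ₀, Real.sqrt (2 * Real.pi) * C, hτ₀, by positivity,
    fun u₀ u hu₀ hu hR τ hτ hττ₀ n hn => ?_⟩
  have hnum := CubicNLS.hasFS_numSol hγ hu₀ τ n
  obtain ⟨B, hB⟩ := CubicNLS.exists_sobBd_numSeq hγ τ
    (CubicNLS.quadForm (fun _ => 1) (fourierCoeff u₀))
    (CubicNLS.quadForm (fun j => (j : ℝ)) (fourierCoeff u₀)) hu₀.sobBd n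
  have hmem := hnum.memH hB
  have hut := hu.memH (n * τ) ⟨by positivity, hn⟩
  refine ⟨hmem, ?_⟩
  have herr := h _ (hu.seqSol hγ hT hR) τ hτ hττ₀ n hn
  rw [show fourierCoeff (u 0) = fourierCoeff u₀ from
    funext fun k => fourierCoeff_congr_ae hu.initial ▸ rfl] at herr
  have hd : CubicNLS.SobBd γ
      (fourierCoeff (u (n * τ) - CubicNLS.numSol τ u₀ n)) (C * τ) :=
    herr.of_norm_le' fun k => by
      rw [CubicNLS.fourierCoeff_sub_apply hγ hut hmem, hnum.fourierCoeff_eq]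
  rw [mul_assoc]
  exact hd.hNorm_le
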